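/- Let $\mathbb{K}$ be an algebraically closed field of characteristic zero, let $2\le n<d$ be integers, let $e\in\mathbb{K}$ be a primitive $d$-th root of unity, and let $0\le\alpha_0\le\cdots\le\alpha_n<d$ be integers, not all equal, with $\gcd(d,\alpha_0,\dots,\alpha_n)=1$. Let $\Gamma=\langle \mathrm{diag}(e^{\alpha_0},\dots,e^{\alpha_n})\rangle$ and $\overline{\Gamma}=\langle \mathrm{diag}(e^{\alpha_0},\dots,e^{\alpha_n}),\mathrm{diag}(e,\dots,e)\rangle$ in $\mathrm{GL}(n+1,\mathbb{K})$, acting on $R=\mathbb{K}[x_0,\dots,x_n]$ by linear substitution. The ring of invariants $R^{\overline{\Gamma}}$ is graded by letting its component of degree $t$ be $R^{\overline{\Gamma}}\cap R_{td}$. Let $m_1,\dots,m_{\mu}$ be all monomials of degree $d$ invariant under $\Gamma$, let $S=\mathbb{K}[w_1,\dots,w_{\mu}]$ with the standard grading, and let $\mathrm{I}(X_d)$ be the kernel of $S\to R$, $w_i\mapsto m_i$, i.e. the homogeneous ideal of the variety $X_d\subset\mathbb{P}^{\mu-1}$ parametrized by $m_1,\dots,m_{\mu}$, whose homogeneous coordinate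 ring is $S/\mathrm{I}(X_d)\cong R^{\overline{\Gamma}}$. For a nonzero finitely generated graded $S$-module $M$ with minimal graded free resolution $\cdots\to F_1\to F_0\to M\to 0$, $F_i=\bigoplus_k S(-b_{i,k})$, put $\mathrm{reg}_S(M)=\max_{i,k}(b_{i,k}-i)$. The Castelnuovo–Mumford regularity of $R^{\overline{\Gamma}}$ is normalized as that of the projective variety $X_d$, that is, $\mathrm{reg}(R^{\overline{\Gamma}}):=\mathrm{reg}_S(\mathrm{I}(X_d))$. Let $\mathrm{relint}(I_d)$ be the ideal of $R^{\overline{\Gamma}}$ generated by all invariant monomials $x_0^{a_0}\cdots x_n^{a_n}$ with $a_0\cdots a_n\neq 0$, and let $\mathcal{C}_{d,1}$ be the set of monomials of degree $d$ in $\mathrm{relint}(I_d)$; equivalently, the set of $\overline{\Gamma}$-invariant monomials of degree $d$ with all exponents positive. Theorem. One has $$n\le \mathrm{reg}(R^{\overline{\Gamma}})\le n+1,$$ and $\mathrm{reg}(R^{\overline{\Gamma}})=n+1$ if and only if $\mathcal{C}_{d,1}\neq\emptyset$. Moreover, $R^{\overline{\Gamma}}$, regarded as a graded $S$-module through $w_i\mapsto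 m_i$, satisfies $\mathrm{reg}_S(R^{\overline{\Gamma}})=\mathrm{reg}_S(\mathrm{I}(X_d))-1$. -/

import Mathlib

/-! ### Graded free resolutions and Castelnuovo–Mumford regularity -/

noncomputable section

/-- The forms of degree `j` in a standard graded polynomial ring, with `j` an arbitrary integer
(only `0` is a form of negative degree). -/
abbrev polyPiece (σ K : Type*) [Field K] (j : ℤ) : Submodule K (MvPolynomial σ K) :=
  MvPolynomial.weightedHomogeneousSubmodule K (fun _ : σ => (1 : ℤ)) j

/-- A minimal graded free resolution
`⋯ → ⨁ₖ S(-shift 1 k) → ⨁ₖ S(-shift 0 k) → M → 0`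
by finitely generated graded free modules over the standard graded polynomial ring
`S = K[w_s : s ∈ σ]`, of an `S`-module `M` whose homogeneous elements of degree `j`
form the subgroup `gr j`. -/
structure MinimalGradedFreeResolution (σ K : Type*) [Field K] {M : Type*} [AddCommGroup M]
    [Module (MvPolynomial σ K) M] (gr : ℤ → AddSubgroup M) where
  /-- the rank of the `i`-th free module -/
  rank : ℕ → ℕ
  /-- the degree of the `k`-th basis vector of the `i`-th free module -/
  shift : (i : ℕ) → Fin (rank i) → ℤ
  /-- the differentials -/
  diff : (i : ℕ) →
    (Fin (rank (i + 1)) → MvPolynomial σ K) →ₗ[MvPolynomial σ K] (Fin (rank i) → MvPolynomial σ K)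
  /-- the augmentation -/
  aug : (Fin (rank 0) → MvPolynomial σ K) →ₗ[MvPolynomial σ K] M
  /-- the differentials preserve degrees -/
  diff_homogeneous : ∀ i k l,
    diff i (Pi.single k 1) l ∈ polyPiece σ K (shift (i + 1) k - shift i l)
  /-- the augmentation preserves degrees -/
  aug_homogeneous : ∀ k, aug (Pi.single k 1) ∈ gr (shift 0 k)
  aug_surjective : Function.Surjective aug
  exact_zero : Function.Exact (diff 0) aug
  exact_succ : ∀ i, Function.Exact (diff (i + 1)) (diff i)
  /-- the differentials are zero modulo the irrelevant maximal ideal -/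
  minimal : ∀ i k l, MvPolynomial.constantCoeff (diff i (Pi.single k 1) l) = 0

/-- `r` is the Castelnuovo–Mumford regularity `max {b - i}` of the graded module `M`, where `b`
runs through the degrees of the basis vectors of the `i`-th module of a minimal graded free
resolution. (The minimal resolution of a finitely generated graded module is unique up to
isomorphism. The relation holds for no `r` if there is no resolution, if `M = 0`, or if the
set is unbounded.) -/
def IsCastelnuovoMumfordRegularity (σ K : Type*) [Field K] {M : Type*} [AddCommGroup M]
    [Module (MvPolynomial σ K) M] (gr : ℤ → AddSubgroup M) (r : ℤ) : Prop :=
  IsGreatest {x : ℤ | ∃ (F : MinimalGradedFreeResolution σ K gr) (i : ℕ) (k : Fin (F.rank i)),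
    x = F.shift i k - i} r

end

/-! ### Rings of invariants -/

noncomputable section

open MvPolynomial

/-- The linear substitution `x_i ↦ ∑ j, g i j * x_j`. -/
def linSubst {m : ℕ} {K : Type*} [Field K] (g : GL (Fin m) K) :
    MvPolynomial (Fin m) K →ₐ[K] MvPolynomial (Fin m) K :=
  aeval fun i => ∑ j, C (g i j) * X j

/-- The ring of polynomial invariants of a linear group. -/
def invariantRing {m : ℕ} {K : Type*} [Field K] (G : Subgroup (GL (Fin m) K)) :
    Subalgebra K (MvPolynomial (Fin m) K) where
  carrier := {p | ∀ g ∈ G, linSubst g p = p}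
  mul_mem' hp hq g hg := by rw [map_mul, hp g hg, hq g hg]
  add_mem' hp hq g hg := by rw [map_add, hp g hg, hq g hg]
  algebraMap_mem' c g _ := AlgHom.commutes (linSubst g) c

/-- The invertible matrix `diag(e ^ α_0, …, e ^ α_n)`. -/
def diagMatrix {n : ℕ} {K : Type*} [Field K] (e : Kˣ) (α : Fin (n + 1) → ℕ) :
    GL (Fin (n + 1)) K where
  val := Matrix.diagonal fun i => (e : K) ^ α i
  inv := Matrix.diagonal fun i => ((e⁻¹ : Kˣ) : K) ^ α i
  val_inv := by
    rw [Matrix.diagonal_mul_diagonal, ← Matrix.diagonal_one]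
    congr 1; funext i; rw [← mul_pow]; simp
  inv_val := by
    rw [Matrix.diagonal_mul_diagonal, ← Matrix.diagonal_one]
    congr 1; funext i; rw [← mul_pow]; simp

/-- The cyclic group `Γ` generated by `diag(e ^ α_0, …, e ^ α_n)`. -/
def Gam {n : ℕ} {K : Type*} [Field K] (e : Kˣ) (α : Fin (n + 1) → ℕ) :
    Subgroup (GL (Fin (n + 1)) K) :=
  Subgroup.closure {diagMatrix e α}

/-- The cyclic extension of `Γ`: the group generated by `diag(e ^ α_0, …, e ^ α_n)` and
`diag(e, …, e)`. -/
def GamBar {n : ℕ} {K : Type*} [Field K] (e : Kˣ) (α : Fin (n + 1) → ℕ) :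
    Subgroup (GL (Fin (n + 1)) K) :=
  Subgroup.closure {diagMatrix e α, diagMatrix e fun _ => 1}

/-- The (exponent vectors of the) monomials of degree `d` that are invariant under `Γ`. -/
def invMonomials {n : ℕ} {K : Type*} [Field K] (d : ℕ) (e : Kˣ) (α : Fin (n + 1) → ℕ) :
    Set (Fin (n + 1) →₀ ℕ) :=
  {a | a.degree = d ∧ monomial a (1 : K) ∈ invariantRing (Gam e α)}

section helpers

variable {m n : ℕ} {K : Type*} [Field K]

theorem linSubst_one (p : MvPolynomial (Fin m) K) : linSubst 1 p = p := by
  have h : linSubst (1 : GL (Fin m) K) = AlgHom.id K _ := by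
    apply MvPolynomial.algHom_ext
    intro i
    simp [linSubst, Matrix.one_apply]
  rw [h]; rfl

theorem linSubst_mul (g h : GL (Fin m) K) (p : MvPolynomial (Fin m) K) :
    linSubst (g * h) p = linSubst h (linSubst g p) := by
  have H : linSubst (g * h) = (linSubst h).comp (linSubst g) := by
    apply MvPolynomial.algHom_ext
    intro i
    simp only [linSubst, aeval_X, AlgHom.comp_apply, map_sum, map_mul, Units.val_mul,
      Matrix.mul_apply, algHom_C, algebraMap_eq, Finset.sum_mul, Finset.mul_sum]
    rw [Finset.sum_comm]
    simp only [mul_assoc]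
  rw [H]; rfl

theorem mem_invariantRing_closure {s : Set (GL (Fin m) K)} {p : MvPolynomial (Fin m) K}
    (h : ∀ g ∈ s, linSubst g p = p) : p ∈ invariantRing (Subgroup.closure s) := by
  intro g hg
  induction hg using Subgroup.closure_induction with
  | mem g hg => exact h g hg
  | one => exact linSubst_one p
  | mul g k _ _ hg hk => rw [linSubst_mul, hg, hk]
  | inv g _ hg =>
    have := linSubst_mul g g⁻¹ p
    rw [mul_inv_cancel, linSubst_one, hg] at this
    exact this.symm

theorem linSubst_scalar (e : Kˣ) (a : Fin (n + 1) →₀ ℕ) :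
    linSubst (diagMatrix e fun _ => 1) (monomial a (1 : K)) =
      C ((e : K) ^ a.degree) * monomial a 1 := by
  have h : ∀ i : Fin (n + 1), ∑ j, C ((diagMatrix e fun _ => 1 : GL (Fin (n + 1)) K) i j) * X j
      = C (e : K) * X i := by
    intro i
    rw [Finset.sum_eq_single i]
    · simp [diagMatrix]
    · intro j _ hj
      simp [diagMatrix, Matrix.diagonal_apply_ne _ hj.symm]
    · simp
  simp only [linSubst, h, aeval_monomial, map_one, one_mul]
  rw [monomial_eq, map_one, one_mul]
  simp only [Finsupp.prod, mul_pow, Finset.prod_mul_distrib, Finset.prod_pow_eq_pow_sum, map_pow,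
    Finsupp.degree]
  rfl

end helpers

/-- A monomial of degree `d` that is invariant under `Γ` is invariant under the extension. -/
theorem monomial_mem_invariantRing_GamBar {n : ℕ} {K : Type*} [Field K] {d : ℕ} {e : Kˣ}
    (he : IsPrimitiveRoot e d) {α : Fin (n + 1) → ℕ} {a : Fin (n + 1) →₀ ℕ}
    (ha : a ∈ invMonomials (K := K) d e α) :
    monomial a (1 : K) ∈ invariantRing (GamBar e α) := by
  apply mem_invariantRing_closure
  rintro g (rfl | rfl)
  · exact ha.2 _ (Subgroup.subset_closure rfl)
  · rw [linSubst_scalar, ha.1, ← Units.val_pow_eq_pow_val, he.pow_eq_one]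
    simp

/-- `S`, the polynomial ring with one variable `w_m` for each monomial invariant `m` of `Γ`
of degree `d`. -/
abbrev coordRing {n : ℕ} {K : Type*} [Field K] (d : ℕ) (e : Kˣ) (α : Fin (n + 1) → ℕ) : Type _ :=
  MvPolynomial (invMonomials (K := K) d e α) K

/-- The morphism `S → R`, `w_m ↦ m`. -/
def rho {n : ℕ} {K : Type*} [Field K] (d : ℕ) (e : Kˣ) (α : Fin (n + 1) → ℕ) :
    coordRing (K := K) d e α →ₐ[K] MvPolynomial (Fin (n + 1)) K :=
  aeval fun a => monomial a.1 (1 : K)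

/-- The homogeneous ideal of the variety parametrized by the monomial invariants of `Γ` of
degree `d`: the kernel of `w_m ↦ m`. -/
def idealX {n : ℕ} {K : Type*} [Field K] (d : ℕ) (e : Kˣ) (α : Fin (n + 1) → ℕ) :
    Ideal (coordRing (K := K) d e α) :=
  RingHom.ker (rho d e α)

/-- The homogeneous elements of the ideal, with the grading of `S`. -/
def idealXPiece {n : ℕ} {K : Type*} [Field K] (d : ℕ) (e : Kˣ) (α : Fin (n + 1) → ℕ) (j : ℤ) :
    AddSubgroup (idealX (K := K) d e α) :=
  (polyPiece (invMonomials (K := K) d e α) K j).toAddSubgroup.comap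
    (idealX (K := K) d e α).subtype.toAddMonoidHom

/-- The morphism `S → R`, `w_m ↦ m`, with values in the ring of invariants of the extension
of `Γ`. -/
def rhoBar {n : ℕ} {K : Type*} [Field K] {d : ℕ} {e : Kˣ} (he : IsPrimitiveRoot e d)
    (α : Fin (n + 1) → ℕ) :
    coordRing (K := K) d e α →ₐ[K] invariantRing (GamBar (K := K) e α) :=
  aeval fun a => ⟨monomial a.1 (1 : K), monomial_mem_invariantRing_GamBar he a.2⟩

/-- The ring of invariants of the extension of `Γ`, as an `S`-module through `w_m ↦ m`. -/
abbrev invariantModule {n : ℕ} {K : Type*} [Field K] {d : ℕ} {e : Kˣ} (he : IsPrimitiveRoot e d)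
    (α : Fin (n + 1) → ℕ) :
    Module (coordRing (K := K) d e α) (invariantRing (GamBar (K := K) e α)) :=
  Module.compHom _ (rhoBar he α).toRingHom

/-- The grading of the ring of invariants of the extension of `Γ`: the component of degree `t`
consists of the invariant forms of degree `t * d` in `x_0, …, x_n`. -/
def invariantPiece {n : ℕ} {K : Type*} [Field K] (d : ℕ) (e : Kˣ) (α : Fin (n + 1) → ℕ) (t : ℤ) :
    AddSubgroup (invariantRing (GamBar (K := K) e α)) :=
  (polyPiece (Fin (n + 1)) K (t * d)).toAddSubgroup.comap
    (invariantRing (GamBar (K := K) e α)).val.toRingHom.toAddMonoidHom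

/-- The ideal of the ring of invariants of the extension of `Γ` that is generated by the
invariant monomials in which every variable occurs. -/
def relint {n : ℕ} {K : Type*} [Field K] (e : Kˣ) (α : Fin (n + 1) → ℕ) :
    Ideal (invariantRing (GamBar (K := K) e α)) :=
  Ideal.span {f | ∃ a : Fin (n + 1) →₀ ℕ, (∀ i, a i ≠ 0) ∧
    (f : MvPolynomial (Fin (n + 1)) K) = monomial a 1}

/-- `𝒞_{d,k}`: the (exponent vectors of the) monomials of degree `k * d` that lie in `relint`. -/
def Cset {n : ℕ} {K : Type*} [Field K] (d : ℕ) (e : Kˣ) (α : Fin (n + 1) → ℕ) (k : ℕ) :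
    Set (Fin (n + 1) →₀ ℕ) :=
  {a | a.degree = k * d ∧ ∃ f ∈ relint (K := K) e α,
    (f : MvPolynomial (Fin (n + 1)) K) = monomial a 1}

end

/-! Write `A` for the invariant ring of the extended group. It is spanned by monomials, and the
exponents `a` that occur are cut out by two congruences: `d` divides the degree of `a` and `∑ α i *
a i`. Hence an invariant monomial divided by an invariant divisor stays invariant. So the powers
`x_i ^ d` form an `A`-regular sequence in every order, and modulo them `A` has as basis the
invariant monomials with all exponents below `d`. The regularity of `A` is the top degree `ρ` of
this finite-dimensional quotient (`regularity_of_isGreatest`).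

Finding `ρ` is combinatorics. Exponents below `d` and degree `t * d` force `t ≤ n`. The complement
`a ↦ d - a` matches such monomials with invariant monomials of degree `(n + 1 - t) * d` and
exponents in `[1, d]`. So `t = n` occurs exactly when `𝒞_{d,1}` is nonempty, and `t = n - 1` always
occurs: starting from `(x_0 ⋯ x_n) ^ d`, the Erdős–Ginzburg–Ziv theorem strips off invariant factors
of degree `d`, sparing one copy of each variable, until degree `2 * d`
(`exists_interior_degree_two`). The same theorem shows that `A` is generated in degree one, so `A =
S / I`, and splicing resolutions gives `reg I = ρ + 1`.

That `ρ` is the regularity (`shift_bounds`) is proved by reducing a minimal resolution `F` modulo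
one variable of `S` after another. Modulo the variables of the `x_i ^ d` only `H_0` survives; it
vanishes above degree `ρ` but not in degree `ρ`. Each further variable preserves the vanishing above
the line `j = i + ρ` (`ExactMod.insert_succ`) and, via the connecting homomorphism, a nonzero class
on that line (`HasClass.insert`). Modulo all variables the differentials vanish by minimality, and
the homology shows the shifts of `F`. -/

/-! ### Graded free modules and ideals generated by variables -/

noncomputable section GradedFree

open MvPolynomial

variable {σ K : Type*} [Field K]

/-- The homogeneous component of degree `j` of a polynomial. -/
abbrev polyComp (j : ℤ) : MvPolynomial σ K →ₗ[K] MvPolynomial σ K :=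
  weightedHomogeneousComponent (fun _ : σ => (1 : ℤ)) j

theorem polyComp_mem (j : ℤ) (p : MvPolynomial σ K) : polyComp j p ∈ polyPiece σ K j :=
  weightedHomogeneousComponent_mem _ _ _

theorem polyComp_of_mem {j : ℤ} {p : MvPolynomial σ K} (hp : p ∈ polyPiece σ K j) :
    polyComp j p = p :=
  IsWeightedHomogeneous.weightedHomogeneousComponent_same hp

theorem polyComp_of_mem_of_ne {j n : ℤ} {p : MvPolynomial σ K} (hp : p ∈ polyPiece σ K j)
    (h : n ≠ j) : polyComp n p = 0 :=
  IsWeightedHomogeneous.weightedHomogeneousComponent_ne n hp h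

theorem polyPiece_mul {a b : ℤ} {p q : MvPolynomial σ K} (hp : p ∈ polyPiece σ K a)
    (hq : q ∈ polyPiece σ K b) : p * q ∈ polyPiece σ K (a + b) :=
  IsWeightedHomogeneous.mul hp hq

theorem monomial_mem_polyPiece (m : σ →₀ ℕ) (c : K) :
    monomial m c ∈ polyPiece σ K (Finsupp.weight (fun _ : σ => (1 : ℤ)) m) :=
  isWeightedHomogeneous_monomial _ _ _ rfl

theorem X_mem_polyPiece (w : σ) : (X w : MvPolynomial σ K) ∈ polyPiece σ K 1 :=
  isWeightedHomogeneous_X _ _ _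

theorem one_mem_polyPiece : (1 : MvPolynomial σ K) ∈ polyPiece σ K 0 :=
  isWeightedHomogeneous_one _ _

theorem weight_one_eq_degree (m : σ →₀ ℕ) :
    Finsupp.weight (fun _ : σ => (1 : ℤ)) m = (m.degree : ℤ) := by
  rw [Finsupp.degree_eq_weight_one]
  simp [Finsupp.weight_apply, Finsupp.sum]

theorem polyComp_mul_of_mem {a : ℤ} (n : ℤ) (p : MvPolynomial σ K) {q : MvPolynomial σ K}
    (hq : q ∈ polyPiece σ K a) : polyComp n (p * q) = polyComp (n - a) p * q := by
  induction p using MvPolynomial.induction_on' with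
  | monomial m c =>
    have hm := monomial_mem_polyPiece (K := K) m c
    by_cases h : Finsupp.weight (fun _ : σ => (1 : ℤ)) m = n - a
    · rw [h] at hm
      rw [polyComp_of_mem hm, polyComp_of_mem]
      simpa using polyPiece_mul hm hq
    · rw [polyComp_of_mem_of_ne hm (Ne.symm h), polyComp_of_mem_of_ne (polyPiece_mul hm hq), zero_mul]
      omega
  | add p q hp hq' => rw [add_mul, map_add, hp, hq', map_add, add_mul]

theorem constantCoeff_polyComp_zero (p : MvPolynomial σ K) :
    polyComp 0 p = C (constantCoeff p) := by
  classical
  ext m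
  rw [coeff_weightedHomogeneousComponent, weight_one_eq_degree, coeff_C]
  by_cases h : m = 0
  · simp [h, constantCoeff_eq]
  · rw [if_neg, if_neg (Ne.symm h)]
    simpa [Finsupp.degree_eq_zero_iff] using h

theorem constantCoeff_eq_zero_of_mem {j : ℤ} {p : MvPolynomial σ K} (hp : p ∈ polyPiece σ K j)
    (hj : j ≠ 0) : constantCoeff p = 0 := by
  have := constantCoeff_polyComp_zero p
  rw [polyComp_of_mem_of_ne hp hj.symm] at this
  simpa using this.symm

/-- The homogeneous elements of degree `j` in the graded free module `⨁ₖ S(-b k)`. -/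
def freePiece {r : ℕ} (b : Fin r → ℤ) (j : ℤ) : Submodule K (Fin r → MvPolynomial σ K) where
  carrier := {x | ∀ l, x l ∈ polyPiece σ K (j - b l)}
  add_mem' hx hy l := add_mem (hx l) (hy l)
  zero_mem' _ := zero_mem _
  smul_mem' c _ hx l := Submodule.smul_mem _ c (hx l)

/-- The projection of the graded free module `⨁ₖ S(-b k)` to its component of degree `j`. -/
def freeComp {r : ℕ} (b : Fin r → ℤ) (j : ℤ) :
    (Fin r → MvPolynomial σ K) →ₗ[K] (Fin r → MvPolynomial σ K) where
  toFun x l := polyComp (j - b l) (x l)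
  map_add' x y := by ext1 l; simp
  map_smul' c x := by ext1 l; simp

theorem freeComp_apply {r : ℕ} (b : Fin r → ℤ) (j : ℤ) (x : Fin r → MvPolynomial σ K)
    (l : Fin r) : freeComp b j x l = polyComp (j - b l) (x l) := rfl

theorem freeComp_mem {r : ℕ} (b : Fin r → ℤ) (j : ℤ) (x : Fin r → MvPolynomial σ K) :
    freeComp b j x ∈ freePiece b j := fun _ => polyComp_mem _ _

theorem freeComp_of_mem {r : ℕ} {b : Fin r → ℤ} {j : ℤ} {x : Fin r → MvPolynomial σ K}
    (hx : x ∈ freePiece b j) : freeComp b j x = x :=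
  funext fun l => polyComp_of_mem (hx l)

theorem freeComp_of_mem_of_ne {r : ℕ} {b : Fin r → ℤ} {j n : ℤ} {x : Fin r → MvPolynomial σ K}
    (hx : x ∈ freePiece b j) (h : n ≠ j) : freeComp b n x = 0 :=
  funext fun l => polyComp_of_mem_of_ne (hx l) (by omega)

theorem single_mem_freePiece {r : ℕ} (b : Fin r → ℤ) {j : ℤ} (k : Fin r) {p : MvPolynomial σ K}
    (hp : p ∈ polyPiece σ K j) : Pi.single k p ∈ freePiece b (j + b k) := by
  intro l
  by_cases h : l = k
  · subst h; simpa using hp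
  · rw [Pi.single_eq_of_ne h]; exact zero_mem _

theorem smul_mem_freePiece {r : ℕ} {b : Fin r → ℤ} {a j : ℤ} {p : MvPolynomial σ K}
    {x : Fin r → MvPolynomial σ K} (hp : p ∈ polyPiece σ K a) (hx : x ∈ freePiece b j) :
    p • x ∈ freePiece b (a + j) := by
  intro l
  have := polyPiece_mul hp (hx l)
  rwa [← add_sub_assoc] at this

theorem map_eq_sum_smul_single {r : ℕ} {M : Type*} [AddCommGroup M] [Module (MvPolynomial σ K) M]
    (φ : (Fin r → MvPolynomial σ K) →ₗ[MvPolynomial σ K] M) (x : Fin r → MvPolynomial σ K) :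
    φ x = ∑ l, x l • φ (Pi.single l 1) := by
  conv_lhs => rw [pi_eq_sum_univ' x, map_sum]
  simp only [map_smul]

/-- A linear map `⨁ₖ S(-b' k) → ⨁ₖ S(-b k)` preserves degrees. -/
def IsDegreePreserving {r r' : ℕ} (b' : Fin r' → ℤ) (b : Fin r → ℤ)
    (φ : (Fin r' → MvPolynomial σ K) →ₗ[MvPolynomial σ K] (Fin r → MvPolynomial σ K)) : Prop :=
  ∀ k l, φ (Pi.single k 1) l ∈ polyPiece σ K (b' k - b l)

theorem IsDegreePreserving.freeComp_map {r r' : ℕ} {b' : Fin r' → ℤ} {b : Fin r → ℤ}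
    {φ : (Fin r' → MvPolynomial σ K) →ₗ[MvPolynomial σ K] (Fin r → MvPolynomial σ K)}
    (hφ : IsDegreePreserving b' b φ) (j : ℤ) (x : Fin r' → MvPolynomial σ K) :
    freeComp b j (φ x) = φ (freeComp b' j x) := by
  rw [map_eq_sum_smul_single φ x, map_eq_sum_smul_single φ (freeComp b' j x)]
  ext1 l
  simp only [freeComp_apply, Finset.sum_apply, Pi.smul_apply, smul_eq_mul, map_sum]
  refine Finset.sum_congr rfl fun k _ => ?_
  rw [polyComp_mul_of_mem _ _ (hφ k l)]
  congr 2
  ring_nf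

theorem IsDegreePreserving.map_mem {r r' : ℕ} {b' : Fin r' → ℤ} {b : Fin r → ℤ}
    {φ : (Fin r' → MvPolynomial σ K) →ₗ[MvPolynomial σ K] (Fin r → MvPolynomial σ K)}
    (hφ : IsDegreePreserving b' b φ) {j : ℤ} {x : Fin r' → MvPolynomial σ K}
    (hx : x ∈ freePiece b' j) : φ x ∈ freePiece b j := by
  rw [← freeComp_of_mem hx, ← hφ.freeComp_map]
  exact freeComp_mem _ _ _

/-- The ideal generated by a set of variables. -/
def varIdeal (K : Type*) [Field K] (T : Set σ) : Ideal (MvPolynomial σ K) :=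
  Ideal.span (X '' T)

theorem mem_varIdeal {T : Set σ} {p : MvPolynomial σ K} :
    p ∈ varIdeal K T ↔ ∀ m ∈ p.support, ∃ i ∈ T, m i ≠ 0 :=
  mem_ideal_span_X_image

theorem varIdeal_mono {T T' : Set σ} (h : T ⊆ T') : varIdeal K T ≤ varIdeal K T' :=
  Ideal.span_mono (Set.image_mono h)

theorem X_mem_varIdeal {T : Set σ} {w : σ} (h : w ∈ T) : X w ∈ varIdeal K T :=
  Ideal.subset_span ⟨w, h, rfl⟩

theorem polyComp_mem_varIdeal {T : Set σ} {p : MvPolynomial σ K} (j : ℤ)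
    (hp : p ∈ varIdeal K T) : polyComp j p ∈ varIdeal K T := by
  classical
  rw [mem_varIdeal] at hp ⊢
  intro m hm
  refine hp m ?_
  rw [mem_support_iff, coeff_weightedHomogeneousComponent] at hm
  rw [mem_support_iff]
  intro h
  simp [h] at hm

/-- Membership is tested monomial by monomial, and multiplying by `X w` leaves the exponents of the
variables in `T` unchanged. -/
theorem mem_varIdeal_of_X_mul_mem {T : Set σ} {w : σ} (hw : w ∉ T) {p : MvPolynomial σ K}
    (hp : X w * p ∈ varIdeal K T) : p ∈ varIdeal K T := by
  classical
  rw [mem_varIdeal] at hp ⊢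
  intro m hm
  obtain ⟨i, hi, h⟩ := hp (Finsupp.single w 1 + m) (by
    rw [mem_support_iff] at hm ⊢
    rwa [coeff_X_mul])
  refine ⟨i, hi, ?_⟩
  have : i ≠ w := fun h => hw (h ▸ hi)
  simpa [Finsupp.single_apply, this.symm] using h

theorem mem_varIdeal_univ {p : MvPolynomial σ K} :
    p ∈ varIdeal K (Set.univ : Set σ) ↔ constantCoeff p = 0 := by
  rw [mem_varIdeal, constantCoeff_eq]
  constructor
  · intro h
    by_contra h0
    obtain ⟨i, -, hi⟩ := h 0 (mem_support_iff.2 h0)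
    exact hi rfl
  · intro h m hm
    by_contra! h0
    have : m = 0 := by ext i; exact h0 i trivial
    exact mem_support_iff.1 hm (this ▸ h)

theorem mem_smul_top_pi {R : Type*} [CommRing R] {r : ℕ} {I : Ideal R} {x : Fin r → R} :
    x ∈ I • (⊤ : Submodule R (Fin r → R)) ↔ ∀ l, x l ∈ I := by
  constructor
  · intro hx l
    refine Submodule.smul_induction_on hx ?_ ?_
    · intro a ha y _
      exact I.mul_mem_right _ ha
    · intro y z hy hz
      exact add_mem hy hz
  · intro h
    rw [pi_eq_sum_univ' x]
    exact Submodule.sum_mem _ fun l _ => Submodule.smul_mem_smul (h l) trivial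

theorem map_mem_smul_top {R M N : Type*} [CommRing R] [AddCommGroup M] [Module R M]
    [AddCommGroup N] [Module R N] (I : Ideal R) (φ : M →ₗ[R] N) {x : M}
    (hx : x ∈ I • (⊤ : Submodule R M)) : φ x ∈ I • (⊤ : Submodule R N) :=
  Submodule.smul_top_le_comap_smul_top I φ hx

theorem exists_map_eq_of_mem_smul_top {R M N : Type*} [CommRing R] [AddCommGroup M] [Module R M]
    [AddCommGroup N] [Module R N] (I : Ideal R) (φ : M →ₗ[R] N) (hφ : Function.Surjective φ)
    {y : N} (hy : y ∈ I • (⊤ : Submodule R N)) : ∃ x ∈ I • (⊤ : Submodule R M), φ x = y := by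
  rw [← LinearMap.range_eq_top.2 hφ, ← Submodule.map_top, ← Submodule.map_smul''] at hy
  exact hy

theorem freeComp_mem_smul_top {r : ℕ} (b : Fin r → ℤ) (j : ℤ) {T : Set σ}
    {x : Fin r → MvPolynomial σ K}
    (hx : x ∈ varIdeal K T • (⊤ : Submodule (MvPolynomial σ K) (Fin r → MvPolynomial σ K))) :
    freeComp b j x ∈ varIdeal K T •
      (⊤ : Submodule (MvPolynomial σ K) (Fin r → MvPolynomial σ K)) := by
  rw [mem_smul_top_pi] at hx ⊢
  exact fun l => polyComp_mem_varIdeal _ (hx l)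

theorem mem_smul_top_of_X_smul_mem {r : ℕ} {T : Set σ} {w : σ} (hw : w ∉ T)
    {x : Fin r → MvPolynomial σ K}
    (hx : (X w : MvPolynomial σ K) • x ∈ varIdeal K T •
      (⊤ : Submodule (MvPolynomial σ K) (Fin r → MvPolynomial σ K))) :
    x ∈ varIdeal K T • (⊤ : Submodule (MvPolynomial σ K) (Fin r → MvPolynomial σ K)) := by
  rw [mem_smul_top_pi] at hx ⊢
  exact fun l => mem_varIdeal_of_X_mul_mem hw (hx l)

theorem exists_eq_add_X_smul {r : ℕ} {T : Set σ} {w : σ} {x : Fin r → MvPolynomial σ K}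
    (h : x ∈ varIdeal K (insert w T) •
      (⊤ : Submodule (MvPolynomial σ K) (Fin r → MvPolynomial σ K))) :
    ∃ u ∈ varIdeal K T • (⊤ : Submodule (MvPolynomial σ K) (Fin r → MvPolynomial σ K)),
      ∃ y, x = u + (X w : MvPolynomial σ K) • y := by
  rw [mem_smul_top_pi] at h
  have h1 : ∀ l, ∃ a, ∃ z ∈ varIdeal K T, x l = a * X w + z := fun l => by
    have := h l
    rwa [varIdeal, Set.image_insert_eq, Ideal.mem_span_insert] at this
  choose a z hz hxz using h1
  refine ⟨z, mem_smul_top_pi.2 hz, a, funext fun l => ?_⟩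
  rw [hxz, Pi.add_apply, Pi.smul_apply, smul_eq_mul, mul_comm, add_comm]

/-- Homogeneous decomposition of an element of `(X w, X t : t ∈ T) F`. -/
theorem exists_eq_add_X_smul_of_mem {r : ℕ} {b : Fin r → ℤ} {j : ℤ} {T : Set σ} {w : σ}
    {x : Fin r → MvPolynomial σ K} (hx : x ∈ freePiece b j)
    (h : x ∈ varIdeal K (insert w T) •
      (⊤ : Submodule (MvPolynomial σ K) (Fin r → MvPolynomial σ K))) :
    ∃ u ∈ varIdeal K T • (⊤ : Submodule (MvPolynomial σ K) (Fin r → MvPolynomial σ K)),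
      ∃ y ∈ freePiece b (j - 1), x = u + (X w : MvPolynomial σ K) • y := by
  obtain ⟨u, hu, y, rfl⟩ := exists_eq_add_X_smul h
  refine ⟨freeComp b j u, freeComp_mem_smul_top _ _ hu, freeComp b (j - 1) y,
    freeComp_mem _ _ _, ?_⟩
  rw [← freeComp_of_mem hx]
  ext1 l
  simp only [freeComp_apply, Pi.add_apply, Pi.smul_apply, smul_eq_mul, map_add]
  rw [mul_comm, polyComp_mul_of_mem _ _ (X_mem_polyPiece w), mul_comm]
  congr 4
  ring

/-- Homogeneous decomposition of an element of `im φ + I F`. -/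
theorem IsDegreePreserving.exists_eq_map_add {r r' : ℕ} {b' : Fin r' → ℤ} {b : Fin r → ℤ}
    {φ : (Fin r' → MvPolynomial σ K) →ₗ[MvPolynomial σ K] (Fin r → MvPolynomial σ K)}
    (hφ : IsDegreePreserving b' b φ) {j : ℤ} {T : Set σ} {x : Fin r → MvPolynomial σ K}
    (hx : x ∈ freePiece b j) (h : x ∈ LinearMap.range φ ⊔ varIdeal K T • ⊤) :
    ∃ z ∈ freePiece b' j,
      ∃ u ∈ varIdeal K T • (⊤ : Submodule (MvPolynomial σ K) (Fin r → MvPolynomial σ K)),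
        x = φ z + u := by
  obtain ⟨_, ⟨z, rfl⟩, u, hu, rfl⟩ := Submodule.mem_sup.1 h
  refine ⟨freeComp b' j z, freeComp_mem _ _ _, freeComp b j u, freeComp_mem_smul_top _ _ hu, ?_⟩
  rw [← hφ.freeComp_map, ← map_add, freeComp_of_mem hx]

end GradedFree

/-! ### Homology of a minimal resolution modulo variables -/

noncomputable section ShiftBounds

open MvPolynomial

variable {σ K : Type*} [Field K] {M : Type*} [AddCommGroup M] [Module (MvPolynomial σ K) M]
  {gr : ℤ → AddSubgroup M}

namespace MinimalGradedFreeResolution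

/-- The cycles of `F / (X t : t ∈ T) F` in homological degree `i`, where the cycles in
homological degree `0` are prescribed to be `Z`. -/
def cycles (F : MinimalGradedFreeResolution σ K gr)
    (Z : Submodule (MvPolynomial σ K) (Fin (F.rank 0) → MvPolynomial σ K)) (T : Set σ) :
    (i : ℕ) → Submodule (MvPolynomial σ K) (Fin (F.rank i) → MvPolynomial σ K)
  | 0 => Z
  | i + 1 => (varIdeal K T • ⊤ : Submodule (MvPolynomial σ K) (Fin (F.rank i) → MvPolynomial σ K)).comap
      (F.diff i)

/-- The boundaries of `F / (X t : t ∈ T) F` in homological degree `i`. -/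
def boundaries (F : MinimalGradedFreeResolution σ K gr) (T : Set σ) (i : ℕ) :
    Submodule (MvPolynomial σ K) (Fin (F.rank i) → MvPolynomial σ K) :=
  LinearMap.range (F.diff i) ⊔ varIdeal K T • ⊤

/-- `F / (X t : t ∈ T) F` has no homology in the bidegrees `(i, j)` with `D i j`. -/
def ExactMod (F : MinimalGradedFreeResolution σ K gr)
    (Z : Submodule (MvPolynomial σ K) (Fin (F.rank 0) → MvPolynomial σ K)) (T : Set σ)
    (D : ℕ → ℤ → Prop) : Prop :=
  ∀ i j, D i j → ∀ x ∈ freePiece (F.shift i) j, x ∈ F.cycles Z T i → x ∈ F.boundaries T i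

/-- A submodule of `F₀` that may serve as the module of cycles modulo `(X t : t ∈ T)`, with
`X w` a nonzerodivisor modulo it. -/
structure IsAdmissible (F : MinimalGradedFreeResolution σ K gr)
    (Z : Submodule (MvPolynomial σ K) (Fin (F.rank 0) → MvPolynomial σ K)) (T : Set σ)
    (w : σ) : Prop where
  boundaries_le : F.boundaries T 0 ≤ Z
  regular : ∀ y, (X w : MvPolynomial σ K) • y ∈ Z → y ∈ Z

variable (F : MinimalGradedFreeResolution σ K gr)
  {Z : Submodule (MvPolynomial σ K) (Fin (F.rank 0) → MvPolynomial σ K)} {T : Set σ} {w : σ}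

theorem mem_cycles_succ {i : ℕ} {x : Fin (F.rank (i + 1)) → MvPolynomial σ K} :
    x ∈ F.cycles Z T (i + 1) ↔ F.diff i x ∈ varIdeal K T •
      (⊤ : Submodule (MvPolynomial σ K) (Fin (F.rank i) → MvPolynomial σ K)) := Iff.rfl

theorem diff_diff (i : ℕ) (x : Fin (F.rank (i + 2)) → MvPolynomial σ K) :
    F.diff i (F.diff (i + 1) x) = 0 :=
  (F.exact_succ i).apply_apply_eq_zero x

theorem diff_isDegreePreserving (i : ℕ) :
    IsDegreePreserving (F.shift (i + 1)) (F.shift i) (F.diff i) :=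
  F.diff_homogeneous i

theorem boundaries_mono {T' : Set σ} (h : T ⊆ T') (i : ℕ) :
    F.boundaries T i ≤ F.boundaries T' i :=
  sup_le_sup le_rfl (Submodule.smul_mono_left (varIdeal_mono h))

theorem smul_top_le_boundaries (i : ℕ) : varIdeal K T • ⊤ ≤ F.boundaries T i := le_sup_right

theorem diff_mem_boundaries (i : ℕ) (x : Fin (F.rank (i + 1)) → MvPolynomial σ K) :
    F.diff i x ∈ F.boundaries T i :=
  Submodule.mem_sup_left ⟨x, rfl⟩

theorem IsAdmissible.boundaries_le_cycles {F : MinimalGradedFreeResolution σ K gr}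
    {Z : Submodule (MvPolynomial σ K) (Fin (F.rank 0) → MvPolynomial σ K)}
    (h : F.IsAdmissible Z T w) : ∀ i, F.boundaries T i ≤ F.cycles Z T i
  | 0 => h.boundaries_le
  | i + 1 => by
    refine sup_le ?_ ?_
    · rintro _ ⟨x, rfl⟩
      rw [mem_cycles_succ, F.diff_diff]
      exact zero_mem _
    · intro x hx
      exact map_mem_smul_top _ (F.diff i) hx

/-- In positive homological degree this holds because `X w` is a nonzerodivisor on the free module
modulo `T`; in degree `0` it is part of admissibility. -/
theorem IsAdmissible.mem_cycles_of_X_smul_mem {F : MinimalGradedFreeResolution σ K gr}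
    {Z : Submodule (MvPolynomial σ K) (Fin (F.rank 0) → MvPolynomial σ K)}
    (h : F.IsAdmissible Z T w) (hw : w ∉ T) :
    ∀ i y, (X w : MvPolynomial σ K) • y ∈ F.cycles Z T i → y ∈ F.cycles Z T i
  | 0, y, hy => h.regular y hy
  | i + 1, y, hy => by
    rw [mem_cycles_succ, map_smul] at hy
    exact mem_smul_top_of_X_smul_mem hw hy

/-- This is the exact sequence `H_{i+1}(F/T)_j → H_{i+1}(F/(T,w))_j → H_i(F/T)_{j-1}` written out on
elements: `hD` makes both outer terms vanish. -/
theorem ExactMod.insert_succ {F : MinimalGradedFreeResolution σ K gr}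
    {Z : Submodule (MvPolynomial σ K) (Fin (F.rank 0) → MvPolynomial σ K)}
    {D : ℕ → ℤ → Prop} (hD : ∀ i j, D (i + 1) j → D i (j - 1)) (hE : F.ExactMod Z T D)
    (hZ : F.IsAdmissible Z T w) (hw : w ∉ T) {i : ℕ} {j : ℤ} (hj : D (i + 1) j)
    {x : Fin (F.rank (i + 1)) → MvPolynomial σ K} (hx : x ∈ freePiece (F.shift (i + 1)) j)
    (hc : F.diff i x ∈ varIdeal K (insert w T) •
      (⊤ : Submodule (MvPolynomial σ K) (Fin (F.rank i) → MvPolynomial σ K))) :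
    x ∈ F.boundaries (insert w T) (i + 1) := by
  have hpres := F.diff_isDegreePreserving i
  obtain ⟨u, hu, y, hy, hxy⟩ := exists_eq_add_X_smul_of_mem (hpres.map_mem hx) hc
  have hycyc : y ∈ F.cycles Z T i := by
    refine hZ.mem_cycles_of_X_smul_mem hw i y (hZ.boundaries_le_cycles i ?_)
    have : (X w : MvPolynomial σ K) • y = F.diff i x - u := by rw [hxy]; abel
    rw [this]
    exact sub_mem (F.diff_mem_boundaries i x) (F.smul_top_le_boundaries i hu)
  -- The class of `y` is the image of `x` under the connecting map. Since it is a boundary,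
  -- correcting `x` by `X w • z` gives a cycle modulo `T` alone.
  obtain ⟨z, hz, v, hv, hyz⟩ := hpres.exists_eq_map_add hy (hE i _ (hD i j hj) y hy hycyc)
  have hxz : x - (X w : MvPolynomial σ K) • z ∈ F.boundaries T (i + 1) := by
    refine hE (i + 1) j hj _ (sub_mem hx ?_) ?_
    · have := smul_mem_freePiece (X_mem_polyPiece (K := K) w) hz
      rwa [add_sub_cancel] at this
    · have : F.diff i (x - (X w : MvPolynomial σ K) • z) = u + (X w : MvPolynomial σ K) • v := by
        rw [map_sub, map_smul, hxy, hyz, smul_add]; abel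
      rw [mem_cycles_succ, this]
      exact add_mem hu (Submodule.smul_mem _ _ hv)
  rw [← sub_add_cancel x ((X w : MvPolynomial σ K) • z)]
  exact add_mem (F.boundaries_mono (Set.subset_insert w T) _ hxz)
    (F.smul_top_le_boundaries _ (Submodule.smul_mem_smul
      (X_mem_varIdeal (Set.mem_insert w T)) trivial))

/-- The cycles of the augmented complex modulo `(X t : t ∈ T)` in homological degree `0`. -/
def augCycles (T : Set σ) :
    Submodule (MvPolynomial σ K) (Fin (F.rank 0) → MvPolynomial σ K) :=
  (varIdeal K T • ⊤ : Submodule (MvPolynomial σ K) M).comap F.aug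

theorem mem_augCycles {x : Fin (F.rank 0) → MvPolynomial σ K} :
    x ∈ F.augCycles T ↔ F.aug x ∈ varIdeal K T • (⊤ : Submodule (MvPolynomial σ K) M) := Iff.rfl

/-- Right exactness of reduction: `F₁ → F₀ → M → 0` stays exact modulo the variables in `T`. -/
theorem augCycles_eq_boundaries (T : Set σ) : F.augCycles T = F.boundaries T 0 := by
  apply le_antisymm
  · intro x hx
    obtain ⟨y, hy, hxy⟩ := exists_map_eq_of_mem_smul_top _ F.aug F.aug_surjective hx
    rw [← sub_add_cancel x y]
    refine add_mem (Submodule.mem_sup_left ((F.exact_zero _).1 ?_)) (Submodule.mem_sup_right hy)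
    rw [map_sub, hxy, sub_self]
  · refine sup_le ?_ ?_
    · rintro _ ⟨x, rfl⟩
      rw [mem_augCycles, F.exact_zero.apply_apply_eq_zero]
      exact zero_mem _
    · intro x hx
      exact map_mem_smul_top _ F.aug hx

/-- A resolution of `M` stays exact modulo an `M`-regular sequence of variables. -/
theorem exactMod_of_regular {Θ : Finset σ}
    (hreg : ∀ T : Set σ, T ⊆ Θ → ∀ w ∈ Θ, w ∉ T → ∀ m : M,
      (X w : MvPolynomial σ K) • m ∈ (varIdeal K T • ⊤ : Submodule (MvPolynomial σ K) M) →
        m ∈ (varIdeal K T • ⊤ : Submodule (MvPolynomial σ K) M))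
    (T : Finset σ) (hT : T ⊆ Θ) : F.ExactMod (F.augCycles (T : Set σ)) T fun _ _ => True := by
  classical
  induction T using Finset.induction_on with
  | empty =>
    rintro (_ | i) j - x - hx
    · rw [← augCycles_eq_boundaries]; exact hx
    · refine Submodule.mem_sup_left ((F.exact_succ i x).1 ?_)
      rw [mem_cycles_succ] at hx
      simpa [varIdeal] using hx
  | insert w T hw ih =>
    have hTΘ : T ⊆ Θ := fun t ht => hT (Finset.mem_insert_of_mem ht)
    -- Regularity of `X w` on `M` modulo `T` pulls back along the augmentation to regularity modulo
    -- `augCycles`.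
    have hadm : F.IsAdmissible (F.augCycles T) T w :=
      ⟨(F.augCycles_eq_boundaries _).ge, fun y hy => by
        rw [mem_augCycles, map_smul] at hy
        exact hreg T (by exact_mod_cast hTΘ) w (hT (Finset.mem_insert_self _ _))
          (by exact_mod_cast hw) _ hy⟩
    rw [Finset.coe_insert]
    rintro (_ | i) j - x hx hc
    · rw [← augCycles_eq_boundaries]; exact hc
    · exact (ih hTΘ).insert_succ (fun _ _ _ => trivial) hadm (by exact_mod_cast hw) trivial hx hc

/-- With `Z = ⊤` the homology in degree `0` is `M` modulo the variables, whereas `augCycles`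
describes the augmented complex, in which it vanishes. -/
theorem isAdmissible_top : F.IsAdmissible ⊤ T w := ⟨le_top, fun _ _ => trivial⟩

/-- Vanishing of the homology of `F / (X t : t ∈ T) F` above the line `j = i + ρ` passes to
larger sets of variables. -/
theorem exactMod_union {ρ : ℤ} {Θ : Set σ}
    (h : F.ExactMod ⊤ Θ fun i j => i + ρ < j) (T : Finset σ) :
    F.ExactMod ⊤ (Θ ∪ T) fun i j => i + ρ < j := by
  classical
  induction T using Finset.induction_on with
  | empty => simpa using h
  | insert w T hw ih =>
    rw [Finset.coe_insert, Set.union_insert]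
    by_cases hwT : w ∈ Θ ∪ T
    · rwa [Set.insert_eq_of_mem hwT]
    rintro (_ | i) j hj x hx hc
    -- Here every element of degree `j` in `F₀` is already a boundary, and boundaries only grow with
    -- the set of variables.
    · exact F.boundaries_mono (Set.subset_insert _ _) _ (ih 0 j hj x hx trivial)
    · exact ih.insert_succ (fun i j h => by push_cast at h; omega) F.isAdmissible_top hwT hj hx hc

/-- Nonvanishing of the homology of `F / (X t : t ∈ T) F` in some bidegree `(i, i + ρ)`. -/
def HasClass (F : MinimalGradedFreeResolution σ K gr) (ρ : ℤ) (T : Set σ) : Prop :=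
  ∃ i, ∃ x ∈ freePiece (F.shift i) (i + ρ), x ∈ F.cycles ⊤ T i ∧ x ∉ F.boundaries T i

/-- Multiplication by `X w` sends a class in bidegree `(i, i + ρ)` above the line, where homology
vanishes. The class therefore lifts through the connecting homomorphism to `H_{i+1}` modulo `insert
w T`, in degree `(i + 1) + ρ`, again on the line. -/
theorem HasClass.insert {F : MinimalGradedFreeResolution σ K gr} {ρ : ℤ}
    (h : F.ExactMod ⊤ T fun i j => i + ρ < j) (hw : w ∉ T) (hc : F.HasClass ρ T) :
    F.HasClass ρ (insert w T) := by
  obtain ⟨i, x, hx, hxc, hxb⟩ := hc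
  have hpres := F.diff_isDegreePreserving i
  have hwx := smul_mem_freePiece (X_mem_polyPiece (K := K) w) hx
  obtain ⟨z, hz, u, hu, hxz⟩ := hpres.exists_eq_map_add hwx
    (h i _ (by omega) _ hwx (Submodule.smul_mem _ _ hxc))
  refine ⟨i + 1, z, ?_, ?_, fun hb => hxb ?_⟩
  · rwa [show ((i + 1 : ℕ) : ℤ) + ρ = 1 + (i + ρ) by push_cast; ring]
  · have : F.diff i z = (X w : MvPolynomial σ K) • x - u := by rw [hxz]; abel
    rw [mem_cycles_succ, this]
    exact sub_mem (Submodule.smul_mem_smul (X_mem_varIdeal (Set.mem_insert w T)) trivial)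
      (Submodule.smul_mono_left (varIdeal_mono (Set.subset_insert w T)) hu)
  -- If the lift `z` were a boundary, cancelling `X w` would make `x` a boundary modulo `T`.
  · obtain ⟨t, -, v, hv, rfl⟩ := (F.diff_isDegreePreserving (i + 1)).exists_eq_map_add hz hb
    obtain ⟨u', hu', y, hvy⟩ := exists_eq_add_X_smul hv
    have hmem : x - F.diff i y ∈ varIdeal K T •
        (⊤ : Submodule (MvPolynomial σ K) (Fin (F.rank i) → MvPolynomial σ K)) := by
      refine mem_smul_top_of_X_smul_mem hw ?_
      have : (X w : MvPolynomial σ K) • (x - F.diff i y) = F.diff i u' + u := by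
        rw [smul_sub, hxz, hvy, map_add, F.diff_diff, map_add, map_smul]; abel
      rw [this]
      exact add_mem (map_mem_smul_top _ _ hu') hu
    rw [← sub_add_cancel x (F.diff i y)]
    exact add_mem (F.smul_top_le_boundaries i hmem) (F.diff_mem_boundaries i y)

theorem hasClass_union {ρ : ℤ} {Θ : Set σ}
    (h : F.ExactMod ⊤ Θ fun i j => i + ρ < j) (hc : F.HasClass ρ Θ) (T : Finset σ) :
    F.HasClass ρ (Θ ∪ T) := by
  classical
  induction T using Finset.induction_on with
  | empty => simpa using hc
  | insert w T hw ih =>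
    rw [Finset.coe_insert, Set.union_insert]
    by_cases hwT : w ∈ Θ ∪ T
    · rwa [Set.insert_eq_of_mem hwT]
    · exact ih.insert (F.exactMod_union h T) hwT

theorem diff_mem_varIdeal_univ (i : ℕ) (x : Fin (F.rank (i + 1)) → MvPolynomial σ K) :
    F.diff i x ∈ varIdeal K (Set.univ : Set σ) •
      (⊤ : Submodule (MvPolynomial σ K) (Fin (F.rank i) → MvPolynomial σ K)) := by
  rw [map_eq_sum_smul_single]
  refine Submodule.sum_mem _ fun k _ => Submodule.smul_mem _ _ (mem_smul_top_pi.2 fun l => ?_)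
  exact mem_varIdeal_univ.2 (F.minimal i k l)

theorem mem_cycles_univ : ∀ i x, x ∈ F.cycles ⊤ (Set.univ : Set σ) i
  | 0, _ => trivial
  | i + 1, x => F.diff_mem_varIdeal_univ i x

theorem boundaries_univ (i : ℕ) :
    F.boundaries (Set.univ : Set σ) i = varIdeal K (Set.univ : Set σ) • ⊤ :=
  sup_eq_right.2 (by rintro _ ⟨x, rfl⟩; exact F.diff_mem_varIdeal_univ i x)

/-- Modulo all variables every element is a cycle and only elements of the irrelevant ideal times
`F` are boundaries, so each basis vector gives a nonzero class in its own degree. -/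
theorem shift_le_of_exactMod {ρ : ℤ} (h : F.ExactMod ⊤ Set.univ fun i j => i + ρ < j)
    (i : ℕ) (k : Fin (F.rank i)) : F.shift i k - i ≤ ρ := by
  by_contra! hlt
  have hmem := h i (F.shift i k) (by omega) (Pi.single k 1)
    (by simpa using single_mem_freePiece (F.shift i) k (one_mem_polyPiece (σ := σ) (K := K)))
    (F.mem_cycles_univ i _)
  rw [boundaries_univ, mem_smul_top_pi] at hmem
  simpa using mem_varIdeal_univ.1 (hmem k)

/-- A nonzero class has a coordinate with nonzero constant term. That coordinate is homogeneous, so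
its degree is `0`, which identifies the shift. -/
theorem HasClass.exists_shift_eq {F : MinimalGradedFreeResolution σ K gr} {ρ : ℤ}
    (h : F.HasClass ρ Set.univ) : ∃ i, ∃ k : Fin (F.rank i), F.shift i k - i = ρ := by
  obtain ⟨i, x, hx, -, hb⟩ := h
  rw [boundaries_univ, mem_smul_top_pi] at hb
  push Not at hb
  obtain ⟨l, hl⟩ := hb
  refine ⟨i, l, ?_⟩
  by_contra hne
  exact hl (mem_varIdeal_univ.2 (constantCoeff_eq_zero_of_mem (hx l) (by omega)))

theorem aug_mem (hgr : ∀ a j (p : MvPolynomial σ K) (m : M), p ∈ polyPiece σ K a → m ∈ gr j →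
      p • m ∈ gr (a + j)) {j : ℤ} {x : Fin (F.rank 0) → MvPolynomial σ K}
    (hx : x ∈ freePiece (F.shift 0) j) : F.aug x ∈ gr j := by
  rw [map_eq_sum_smul_single]
  refine sum_mem fun l _ => ?_
  have := hgr _ _ _ _ (hx l) (F.aug_homogeneous l)
  rwa [sub_add_cancel] at this

/-- Suppose that the variables in `Θ` form an `M`-regular sequence in every order, and that
`ρ` is the largest degree in which `M / (X t : t ∈ Θ) M` does not vanish. Then `ρ` is the
largest of the numbers `b - i`, where `b` is a degree of a generator of the `i`-th module of a
minimal graded free resolution of `M`. The nonvanishing in degree `ρ` is witnessed by a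
functional `f`. -/
theorem shift_bounds [Finite σ] {Θ : Finset σ} {ρ : ℤ}
    (hgr : ∀ a j (p : MvPolynomial σ K) (m : M), p ∈ polyPiece σ K a → m ∈ gr j →
      p • m ∈ gr (a + j))
    (hreg : ∀ T : Set σ, T ⊆ Θ → ∀ w ∈ Θ, w ∉ T → ∀ m : M,
      (X w : MvPolynomial σ K) • m ∈ (varIdeal K T • ⊤ : Submodule (MvPolynomial σ K) M) →
        m ∈ (varIdeal K T • ⊤ : Submodule (MvPolynomial σ K) M))
    (htop : ∀ j, ρ < j → ∀ m ∈ gr j,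
      m ∈ (varIdeal K (Θ : Set σ) • ⊤ : Submodule (MvPolynomial σ K) M))
    (f : M →+ K) (hf : ∀ m ∈ (varIdeal K (Θ : Set σ) • ⊤ : Submodule (MvPolynomial σ K) M),
      f m = 0)
    (hfgr : ∀ j, j ≠ ρ → ∀ m ∈ gr j, f m = 0) (hfne : ∃ m, f m ≠ 0) :
    (∀ i k, F.shift i k - i ≤ ρ) ∧ ∃ i, ∃ k : Fin (F.rank i), F.shift i k - i = ρ := by
  classical
  have := Fintype.ofFinite σ
  -- Regularity kills the homology in positive homological degree; in degree `0` it is `M` modulo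
  -- `Θ`, controlled by `htop`.
  have hE : F.ExactMod ⊤ (Θ : Set σ) fun i j => i + ρ < j := by
    rintro (_ | i) j hj x hx hc
    · rw [← augCycles_eq_boundaries]
      exact htop j (by simpa using hj) _ (F.aug_mem hgr hx)
    · exact F.exactMod_of_regular hreg Θ subset_rfl (i + 1) j trivial x hx hc
  -- The pieces `gr j` are not assumed to decompose `M`, so an element of `M` has no component of
  -- degree `ρ`. The component is taken in `F₀` instead, and `f` does not see the other degrees.
  have hfx : ∀ x, f (F.aug x) = f (F.aug (freeComp (F.shift 0) ρ x)) := by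
    intro x
    rw [pi_eq_sum_univ' x]
    simp only [map_sum]
    refine Finset.sum_congr rfl fun l _ => ?_
    rw [← Pi.single_smul', smul_eq_mul, mul_one]
    induction x l using MvPolynomial.induction_on' with
    | monomial m c =>
      have hm := single_mem_freePiece (F.shift 0) l (monomial_mem_polyPiece (K := K) m c)
      by_cases hd : Finsupp.weight (fun _ : σ => (1 : ℤ)) m + F.shift 0 l = ρ
      · rw [hd] at hm; rw [freeComp_of_mem hm]
      · rw [freeComp_of_mem_of_ne hm (Ne.symm hd), map_zero, map_zero,
          hfgr _ hd _ (F.aug_mem hgr hm)]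
    | add p q hp hq =>
      rw [Pi.single_add, map_add, map_add, hp, hq, map_add, map_add, map_add]
  have hC : F.HasClass ρ (Θ : Set σ) := by
    obtain ⟨m, hm⟩ := hfne
    obtain ⟨x, rfl⟩ := F.aug_surjective m
    refine ⟨0, freeComp (F.shift 0) ρ x, by simpa using freeComp_mem _ _ _, trivial, fun hb => ?_⟩
    rw [← augCycles_eq_boundaries] at hb
    rw [hfx] at hm
    exact hm (hf _ hb)
  have hu : (Θ : Set σ) ∪ ((Finset.univ : Finset σ) : Set σ) = Set.univ := by simp
  exact ⟨F.shift_le_of_exactMod (hu ▸ F.exactMod_union hE Finset.univ),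
    HasClass.exists_shift_eq (hu ▸ F.hasClass_union hE hC Finset.univ)⟩

end MinimalGradedFreeResolution

end ShiftBounds

/-! ### Existence of minimal graded free resolutions -/

noncomputable section ResolutionExistence

open MvPolynomial

variable {σ K : Type*} [Field K]

/-- A submodule of the graded free module `⨁ₖ S(-b k)` is generated by homogeneous elements. -/
def IsGradedSubmodule {r : ℕ} (b : Fin r → ℤ)
    (N : Submodule (MvPolynomial σ K) (Fin r → MvPolynomial σ K)) : Prop :=
  ∀ j, ∀ x ∈ N, freeComp b j x ∈ N

theorem IsDegreePreserving.isGradedSubmodule_ker {r r' : ℕ} {b' : Fin r' → ℤ} {b : Fin r → ℤ}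
    {φ : (Fin r' → MvPolynomial σ K) →ₗ[MvPolynomial σ K] (Fin r → MvPolynomial σ K)}
    (hφ : IsDegreePreserving b' b φ) : IsGradedSubmodule b' (LinearMap.ker φ) := by
  intro j x hx
  rw [LinearMap.mem_ker] at hx ⊢
  rw [← hφ.freeComp_map, hx, map_zero]

theorem mem_span_freeComp {r : ℕ} (b : Fin r → ℤ) (x : Fin r → MvPolynomial σ K) :
    x ∈ Submodule.span (MvPolynomial σ K) (Set.range fun j => freeComp b j x) := by
  classical
  let J : Finset ℤ := Finset.univ.biUnion fun l => (x l).support.image fun m =>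
    Finsupp.weight (fun _ : σ => (1 : ℤ)) m + b l
  have : x = ∑ j ∈ J, freeComp b j x := by
    ext l m
    simp only [Finset.sum_apply, freeComp_apply, coeff_sum, coeff_weightedHomogeneousComponent]
    by_cases hm : coeff m (x l) = 0
    · simp [hm]
    · rw [Finset.sum_eq_single (Finsupp.weight (fun _ : σ => (1 : ℤ)) m + b l)]
      · simp
      · intro j _ hj
        rw [if_neg]
        omega
      · intro h
        refine absurd ?_ h
        simp only [J, Finset.mem_biUnion, Finset.mem_image]
        exact ⟨l, Finset.mem_univ _, m, mem_support_iff.2 hm, rfl⟩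
  rw [this]
  refine Submodule.sum_mem _ fun j _ => Submodule.subset_span ⟨j, ?_⟩
  rw [← this]

theorem IsGradedSubmodule.span_homogeneous {r : ℕ} {b : Fin r → ℤ}
    {N : Submodule (MvPolynomial σ K) (Fin r → MvPolynomial σ K)} (hN : IsGradedSubmodule b N) :
    Submodule.span (MvPolynomial σ K) {x | x ∈ N ∧ ∃ j, x ∈ freePiece b j} = N := by
  apply le_antisymm
  · exact Submodule.span_le.2 fun x hx => hx.1
  · intro x hx
    refine Submodule.span_mono ?_ (mem_span_freeComp b x)
    rintro _ ⟨j, rfl⟩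
    exact ⟨hN j x hx, j, freeComp_mem _ _ _⟩

/-- `N` is the image of a degree preserving map from a graded free module of rank `m`. -/
def IsGradedQuotientOfRank {r : ℕ} (b : Fin r → ℤ)
    (N : Submodule (MvPolynomial σ K) (Fin r → MvPolynomial σ K)) (m : ℕ) : Prop :=
  ∃ (c : Fin m → ℤ) (φ : (Fin m → MvPolynomial σ K) →ₗ[MvPolynomial σ K]
    (Fin r → MvPolynomial σ K)), IsDegreePreserving c b φ ∧ LinearMap.range φ = N

/-- By noetherianity, finitely many of the homogeneous elements of `N` already generate it. -/
theorem IsGradedSubmodule.exists_isGradedQuotientOfRank [Finite σ] {r : ℕ} {b : Fin r → ℤ}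
    {N : Submodule (MvPolynomial σ K) (Fin r → MvPolynomial σ K)} (hN : IsGradedSubmodule b N) :
    ∃ m, IsGradedQuotientOfRank b N m := by
  have hfg : (Submodule.span (MvPolynomial σ K) {x | x ∈ N ∧ ∃ j, x ∈ freePiece b j}).FG :=
    IsNoetherian.noetherian _
  obtain ⟨s, hs, hspan⟩ := Submodule.fg_span_iff_fg_span_finset_subset _ |>.1 hfg
  rw [hN.span_homogeneous] at hspan
  have hc : ∀ k : Fin s.card, ∃ j, (s.equivFin.symm k : Fin r → MvPolynomial σ K) ∈ freePiece b j :=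
    fun k => (hs (s.equivFin.symm k).2).2
  choose c hc using hc
  refine ⟨s.card, c, Fintype.linearCombination _ fun k => (s.equivFin.symm k).1, ?_, ?_⟩
  · intro k l
    rw [Fintype.linearCombination_apply_single, one_smul]
    exact hc k l
  · rw [Fintype.range_linearCombination, hspan]
    congr 1
    ext x
    constructor
    · rintro ⟨k, rfl⟩
      exact (s.equivFin.symm k).2
    · intro hx
      exact ⟨s.equivFin ⟨x, hx⟩, by simp⟩

/-- A graded submodule of a graded free module has a minimal cover by a graded free module. -/
theorem IsGradedSubmodule.exists_minimal_cover [Finite σ] {r : ℕ} {b : Fin r → ℤ}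
    {N : Submodule (MvPolynomial σ K) (Fin r → MvPolynomial σ K)} (hN : IsGradedSubmodule b N) :
    ∃ (m : ℕ) (c : Fin m → ℤ) (φ : (Fin m → MvPolynomial σ K) →ₗ[MvPolynomial σ K]
      (Fin r → MvPolynomial σ K)), IsDegreePreserving c b φ ∧ LinearMap.range φ = N ∧
      ∀ x ∈ LinearMap.ker φ, ∀ k, constantCoeff (x k) = 0 := by
  classical
  -- A cover of least rank is minimal: a relation with a nonzero constant coefficient would make a
  -- generator redundant.
  have hex := hN.exists_isGradedQuotientOfRank
  obtain ⟨c, φ, hφ, hr⟩ := Nat.find_spec hex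
  refine ⟨Nat.find hex, c, φ, hφ, hr, ?_⟩
  have hmin : ∀ m < Nat.find hex, ¬ IsGradedQuotientOfRank b N m := fun m hm => Nat.find_min hex hm
  generalize Nat.find hex = m at c φ hφ hr hmin
  by_contra! hcon
  obtain ⟨x, hx, k, hk⟩ := hcon
  obtain _ | m := m
  · exact k.elim0
  refine hmin m (Nat.lt_succ_self m) ⟨c ∘ k.succAbove,
    Fintype.linearCombination _ fun l => φ (Pi.single (k.succAbove l) 1), ?_, ?_⟩
  · intro l i
    rw [Fintype.linearCombination_apply_single, one_smul]
    exact hφ _ _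
  · rw [Fintype.range_linearCombination]
    set P := Submodule.span (MvPolynomial σ K)
      (Set.range fun l => φ (Pi.single (k.succAbove l) 1)) with hP
    have hmem : ∀ l, φ (Pi.single (k.succAbove l) 1) ∈ P := fun l =>
      Submodule.subset_span ⟨l, rfl⟩
    -- In the component of degree `c k` of the relation, the coefficient of the `k`-th generator is
    -- a nonzero constant, so that generator can be solved for.
    have hker : φ (freeComp c (c k) x) = 0 := by
      rw [← hφ.freeComp_map, LinearMap.mem_ker.1 hx, map_zero]
    rw [map_eq_sum_smul_single, Fin.sum_univ_succAbove _ k, freeComp_apply, sub_self,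
      constantCoeff_polyComp_zero] at hker
    have hk1 : φ (Pi.single k 1) ∈ P := by
      have h1 : (C (constantCoeff (x k)) : MvPolynomial σ K) • φ (Pi.single k 1) ∈ P := by
        rw [eq_neg_of_add_eq_zero_left hker]
        exact neg_mem (Submodule.sum_mem _ fun l _ => Submodule.smul_mem _ _ (hmem l))
      have h2 := P.smul_mem (C (constantCoeff (x k))⁻¹ : MvPolynomial σ K) h1
      rwa [smul_smul, ← C_mul, inv_mul_cancel₀ hk, C_1, one_smul] at h2
    rw [← hr]
    apply le_antisymm
    · exact Submodule.span_le.2 (by rintro _ ⟨l, rfl⟩; exact ⟨_, rfl⟩)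
    · rintro _ ⟨y, rfl⟩
      rw [map_eq_sum_smul_single, Fin.sum_univ_succAbove _ k]
      exact add_mem (Submodule.smul_mem _ _ hk1)
        (Submodule.sum_mem _ fun l _ => Submodule.smul_mem _ _ (hmem l))

/-- A graded submodule of some graded free module of finite rank. -/
structure GradedSubmodule (σ K : Type*) [Field K] where
  /-- the rank of the ambient module -/
  rank : ℕ
  /-- the degrees of the basis of the ambient module -/
  shift : Fin rank → ℤ
  /-- the submodule -/
  carrier : Submodule (MvPolynomial σ K) (Fin rank → MvPolynomial σ K)
  isGraded : IsGradedSubmodule shift carrier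

namespace GradedSubmodule

variable [Finite σ] (N : GradedSubmodule σ K)

/-- The rank of the minimal cover of a graded submodule. -/
def coverRank : ℕ := N.isGraded.exists_minimal_cover.choose

/-- The degrees of the basis of the minimal cover of a graded submodule. -/
def coverShift : Fin N.coverRank → ℤ := N.isGraded.exists_minimal_cover.choose_spec.choose

/-- The minimal cover of a graded submodule. -/
def cover : (Fin N.coverRank → MvPolynomial σ K) →ₗ[MvPolynomial σ K]
    (Fin N.rank → MvPolynomial σ K) :=
  N.isGraded.exists_minimal_cover.choose_spec.choose_spec.choose

theorem cover_spec : IsDegreePreserving N.coverShift N.shift N.cover ∧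
    LinearMap.range N.cover = N.carrier ∧
      ∀ x ∈ LinearMap.ker N.cover, ∀ k, constantCoeff (x k) = 0 :=
  N.isGraded.exists_minimal_cover.choose_spec.choose_spec.choose_spec

/-- The first syzygy module. -/
def syzygy : GradedSubmodule σ K where
  rank := N.coverRank
  shift := N.coverShift
  carrier := LinearMap.ker N.cover
  isGraded := N.cover_spec.1.isGradedSubmodule_ker

/-- The `i`-th syzygy module. -/
def iterSyzygy : ℕ → GradedSubmodule σ K
  | 0 => N
  | i + 1 => (iterSyzygy i).syzygy

/-- A graded module that is isomorphic to a graded submodule of a free module of finite rank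
has a minimal graded free resolution. -/
def resolution {M : Type*} [AddCommGroup M] [Module (MvPolynomial σ K) M]
    {gr : ℤ → AddSubgroup M} (ι : M →ₗ[MvPolynomial σ K] (Fin N.rank → MvPolynomial σ K))
    (hι : Function.Injective ι) (hrange : LinearMap.range ι = N.carrier)
    (hgr : ∀ j m, ι m ∈ freePiece N.shift j → m ∈ gr j) : MinimalGradedFreeResolution σ K gr where
  -- The syzygy module of index `i + 1` lies in the cover of the one of index `i`; its ambient
  -- module is thus the `i`-th free module.
  rank i := (N.iterSyzygy (i + 1)).rank
  shift i := (N.iterSyzygy (i + 1)).shift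
  diff i := (N.iterSyzygy (i + 1)).cover
  aug := (LinearEquiv.ofInjective ι hι).symm.toLinearMap ∘ₗ
    (LinearMap.codRestrict (LinearMap.range ι) N.cover fun x => by
      rw [hrange, ← N.cover_spec.2.1]; exact ⟨x, rfl⟩)
  diff_homogeneous i := (N.iterSyzygy (i + 1)).cover_spec.1
  aug_homogeneous k := by
    apply hgr
    rw [LinearMap.comp_apply]
    have h : ∀ y, ι ((LinearEquiv.ofInjective ι hι).symm y) = y := fun y =>
      congrArg Subtype.val ((LinearEquiv.ofInjective ι hι).apply_symm_apply y)
    change ι ((LinearEquiv.ofInjective ι hι).symm _) ∈ _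
    rw [h]
    exact N.cover_spec.1 k
  aug_surjective := by
    rw [LinearMap.coe_comp]
    refine (LinearEquiv.surjective _).comp ?_
    rintro ⟨y, hy⟩
    have hy' := hy
    rw [hrange, ← N.cover_spec.2.1] at hy'
    obtain ⟨x, rfl⟩ := hy'
    exact ⟨x, rfl⟩
  exact_zero x := by
    rw [LinearMap.comp_apply]
    have h2 := (N.iterSyzygy 1).cover_spec.2.1
    change _ ↔ x ∈ LinearMap.range (N.iterSyzygy 1).cover
    rw [h2]
    change _ ↔ N.cover x = 0
    exact (LinearEquiv.map_eq_zero_iff _).trans Subtype.ext_iff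
  exact_succ i x := by
    change _ ↔ x ∈ LinearMap.range (N.iterSyzygy (i + 2)).cover
    rw [(N.iterSyzygy (i + 2)).cover_spec.2.1]
    exact Iff.rfl
  minimal i k := (N.iterSyzygy i).cover_spec.2.2 _ (by
    have : (N.iterSyzygy (i + 1)).cover (Pi.single k 1) ∈ (N.iterSyzygy (i + 1)).carrier := by
      rw [← (N.iterSyzygy (i + 1)).cover_spec.2.1]; exact ⟨_, rfl⟩
    exact this)

end GradedSubmodule

/-- The homogeneous elements of degree `j` of an ideal. -/
abbrev idealPiece (I : Ideal (MvPolynomial σ K)) (j : ℤ) : AddSubgroup I :=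
  (polyPiece σ K j).toAddSubgroup.comap I.subtype.toAddMonoidHom

theorem exists_resolution_ideal [Finite σ] {I : Ideal (MvPolynomial σ K)}
    (hI : ∀ j, ∀ p ∈ I, polyComp j p ∈ I) :
    Nonempty (MinimalGradedFreeResolution σ K (idealPiece I)) := by
  let N : GradedSubmodule σ K :=
    { rank := 1
      shift := 0
      carrier := Submodule.pi Set.univ fun _ => I
      isGraded := fun j x hx l hl => by
        rw [freeComp_apply]
        exact hI _ _ (hx l hl) }
  refine ⟨N.resolution (LinearMap.pi fun _ => I.subtype) ?_ ?_ ?_⟩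
  · intro a b h
    exact Subtype.ext (congrFun h (0 : Fin 1))
  · ext x
    constructor
    · rintro ⟨a, rfl⟩ l -
      exact a.2
    · intro hx
      refine ⟨⟨x 0, hx 0 trivial⟩, funext fun l => ?_⟩
      rw [Subsingleton.elim l (0 : Fin 1)]
      rfl
  · intro j m hm
    have := hm (0 : Fin 1)
    rwa [show j - N.shift (0 : Fin 1) = j from sub_zero j] at this

/-! ### From resolutions of an ideal to resolutions of the quotient -/

namespace MinimalGradedFreeResolution

variable {M : Type*} [AddCommGroup M] [Module (MvPolynomial σ K) M] {gr : ℤ → AddSubgroup M}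
  {I : Ideal (MvPolynomial σ K)}

/-- The ranks of the resolution of `S / I` obtained from a resolution of `I`. -/
def quotientRank (F : MinimalGradedFreeResolution σ K (idealPiece I)) : ℕ → ℕ
  | 0 => 1
  | i + 1 => F.rank i

/-- The shifts of the resolution of `S / I` obtained from a resolution of `I`. -/
def quotientShift (F : MinimalGradedFreeResolution σ K (idealPiece I)) :
    (i : ℕ) → Fin (F.quotientRank i) → ℤ
  | 0 => 0
  | i + 1 => F.shift i

/-- The differentials of the resolution of `S / I` obtained from a resolution of `I`. -/
def quotientDiff (F : MinimalGradedFreeResolution σ K (idealPiece I)) :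
    (i : ℕ) → (Fin (F.quotientRank (i + 1)) → MvPolynomial σ K) →ₗ[MvPolynomial σ K]
      (Fin (F.quotientRank i) → MvPolynomial σ K)
  | 0 => LinearMap.pi fun _ => I.subtype ∘ₗ F.aug
  | i + 1 => F.diff i

/-- The minimal graded free resolution of a cyclic module `M` generated in degree `0` that is
obtained from one of the kernel of `S → M`. -/
def quotient (F : MinimalGradedFreeResolution σ K (idealPiece I))
    (π : MvPolynomial σ K →ₗ[MvPolynomial σ K] M) (hπ : Function.Surjective π)
    (hker : LinearMap.ker π = I) (hone : π 1 ∈ gr 0) (hI : ∀ p ∈ I, constantCoeff p = 0) :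
    MinimalGradedFreeResolution σ K gr where
  rank := F.quotientRank
  shift := F.quotientShift
  diff := F.quotientDiff
  aug := π ∘ₗ LinearMap.proj (0 : Fin 1)
  diff_homogeneous
    | 0, k, l => by
      have := F.aug_homogeneous k
      change _ ∈ polyPiece σ K (F.shift 0 k - 0)
      rwa [sub_zero]
    | i + 1, k, l => F.diff_homogeneous i k l
  aug_homogeneous k := by
    obtain rfl : k = (0 : Fin 1) := Subsingleton.elim (α := Fin 1) _ _
    change π ((Pi.single (0 : Fin 1) 1 : Fin 1 → MvPolynomial σ K) 0) ∈ gr 0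
    rwa [Pi.single_eq_same]
  aug_surjective m := by
    obtain ⟨p, rfl⟩ := hπ m
    exact ⟨fun _ => p, rfl⟩
  exact_zero x := by
    change π (x (0 : Fin 1)) = 0 ↔ _
    rw [← LinearMap.mem_ker, hker]
    constructor
    · intro hx
      obtain ⟨y, hy⟩ := F.aug_surjective ⟨_, hx⟩
      refine ⟨y, funext fun l => ?_⟩
      obtain rfl : l = (0 : Fin 1) := Subsingleton.elim (α := Fin 1) _ _
      exact congrArg Subtype.val hy
    · rintro ⟨y, rfl⟩
      exact (F.aug y).2
  exact_succ
    | 0, x => by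
      refine Iff.trans ?_ (F.exact_zero x)
      constructor
      · intro h
        exact Subtype.ext (congrFun h (0 : Fin 1))
      · intro h
        funext l
        exact congrArg Subtype.val h
    | i + 1, x => F.exact_succ i x
  minimal
    | 0, k, _ => hI _ (F.aug (Pi.single k 1)).2
    | i + 1, k, l => F.minimal i k l

/-- If all minimal graded free resolutions of the cyclic module `M = S / I` have regularity
`ρ > 0`, then `M` has regularity `ρ` and `I` has regularity `ρ + 1`. -/
theorem isCastelnuovoMumfordRegularity_of_shift_bounds [Finite σ] {ρ : ℤ} (hρ : 0 < ρ)
    (π : MvPolynomial σ K →ₗ[MvPolynomial σ K] M) (hπ : Function.Surjective π)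
    (hker : LinearMap.ker π = I) (hone : π 1 ∈ gr 0) (hI : ∀ p ∈ I, constantCoeff p = 0)
    (hgraded : ∀ j, ∀ p ∈ I, polyComp j p ∈ I)
    (hbound : ∀ F : MinimalGradedFreeResolution σ K gr,
      (∀ i k, F.shift i k - i ≤ ρ) ∧ ∃ i, ∃ k : Fin (F.rank i), F.shift i k - i = ρ) :
    IsCastelnuovoMumfordRegularity σ K gr ρ ∧
      IsCastelnuovoMumfordRegularity σ K (idealPiece I) (ρ + 1) := by
  obtain ⟨G⟩ := exists_resolution_ideal hgraded
  obtain ⟨i, k, hik⟩ := (hbound (G.quotient π hπ hker hone hI)).2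
  refine ⟨⟨⟨_, i, k, hik.symm⟩, ?_⟩, ?_, ?_⟩
  · rintro _ ⟨F, i, k, rfl⟩
    exact (hbound F).1 i k
  -- The new module `S` in position `0` contributes only the value `0`, so `ρ > 0` is attained at a
  -- module coming from the resolution of `I`.
  · obtain _ | i := i
    · change (0 : ℤ) - ((0 : ℕ) : ℤ) = ρ at hik
      simp at hik
      omega
    · change G.shift i k - ((i + 1 : ℕ) : ℤ) = ρ at hik
      refine ⟨G, i, k, ?_⟩
      push_cast at hik
      omega
  · rintro _ ⟨F, i, k, rfl⟩
    have h : F.shift i k - ((i + 1 : ℕ) : ℤ) ≤ ρ :=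
      (hbound (F.quotient π hπ hker hone hI)).1 (i + 1) k
    push_cast at h
    omega

end MinimalGradedFreeResolution

end ResolutionExistence

/-! ### Invariant monomials and the Erdős–Ginzburg–Ziv theorem -/

noncomputable section InvariantMonomials

open MvPolynomial

variable {n : ℕ} {K : Type*} [Field K] {d : ℕ} {e : Kˣ} {α : Fin (n + 1) → ℕ}

theorem coeff_linSubst_diagMatrix (β : Fin (n + 1) → ℕ) (p : MvPolynomial (Fin (n + 1)) K)
    (a : Fin (n + 1) →₀ ℕ) :
    coeff a (linSubst (diagMatrix e β) p) = (e : K) ^ (∑ i, β i * a i) * coeff a p := by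
  classical
  have h : ∀ i : Fin (n + 1), ∑ j, C ((diagMatrix e β : GL (Fin (n + 1)) K) i j) * X j
      = C ((e : K) ^ β i) * X i := by
    intro i
    rw [Finset.sum_eq_single i]
    · simp [diagMatrix]
    · intro j _ hj
      simp [diagMatrix, Matrix.diagonal_apply_ne _ hj.symm]
    · simp
  induction p using MvPolynomial.induction_on' with
  | monomial m c =>
    have hm : linSubst (diagMatrix e β) (monomial m c) =
        C ((e : K) ^ (∑ i, β i * m i)) * monomial m c := by
      simp only [linSubst, h, aeval_monomial, algebraMap_eq]
      rw [monomial_eq, Finsupp.prod_fintype _ _ (by simp), Finsupp.prod_fintype _ _ (by simp)]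
      simp only [mul_pow, Finset.prod_mul_distrib, ← map_pow, ← pow_mul, ← map_prod,
        Finset.prod_pow_eq_pow_sum]
      ring
    rw [hm, coeff_C_mul, coeff_monomial]
    split_ifs with hma
    · rw [hma]
    · simp
  | add p q hp hq => rw [map_add, coeff_add, hp, hq, coeff_add, mul_add]

/-- A diagonal matrix scales each monomial by a power of `e`; primitivity turns triviality of this
factor into a congruence modulo `d`. -/
theorem linSubst_diagMatrix_eq_self_iff (he : IsPrimitiveRoot e d) (β : Fin (n + 1) → ℕ)
    (p : MvPolynomial (Fin (n + 1)) K) :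
    linSubst (diagMatrix e β) p = p ↔ ∀ a ∈ p.support, d ∣ ∑ i, β i * a i := by
  rw [MvPolynomial.ext_iff]
  refine forall_congr' fun a => ?_
  rw [coeff_linSubst_diagMatrix, mem_support_iff, ← he.pow_eq_one_iff_dvd, Units.ext_iff,
    Units.val_pow_eq_pow_val, Units.val_one]
  by_cases h : coeff a p = 0
  · simp [h]
  · simp [h]

variable (d α) in
/-- The exponent vectors of the monomials that are invariant under the extension of `Γ`. -/
def invExponents : AddSubmonoid (Fin (n + 1) →₀ ℕ) where
  carrier := {a | d ∣ a.degree ∧ d ∣ ∑ i, α i * a i}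
  zero_mem' := by simp
  add_mem' {a b} ha hb := by
    refine ⟨?_, ?_⟩
    · rw [map_add]; exact dvd_add ha.1 hb.1
    · simp only [Finsupp.add_apply, mul_add, Finset.sum_add_distrib]
      exact dvd_add ha.2 hb.2

theorem mem_invExponents {a : Fin (n + 1) →₀ ℕ} :
    a ∈ invExponents d α ↔ d ∣ a.degree ∧ d ∣ ∑ i, α i * a i := Iff.rfl

/-- Being cut out by congruences, the monoid is closed under those differences that are nonnegative.
This is what makes the `x_i ^ d` a regular sequence. -/
theorem mem_invExponents_of_add_mem {a b : Fin (n + 1) →₀ ℕ} (hb : b ∈ invExponents d α)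
    (h : a + b ∈ invExponents d α) : a ∈ invExponents d α := by
  rw [mem_invExponents, map_add] at h
  simp only [Finsupp.add_apply, mul_add, Finset.sum_add_distrib] at h
  exact ⟨(Nat.dvd_add_left hb.1).1 h.1, (Nat.dvd_add_left hb.2).1 h.2⟩

theorem mem_invariantRing_GamBar (he : IsPrimitiveRoot e d)
    {p : MvPolynomial (Fin (n + 1)) K} :
    p ∈ invariantRing (GamBar e α) ↔ ∀ a ∈ p.support, a ∈ invExponents d α := by
  have h1 : p ∈ invariantRing (GamBar e α) ↔
      linSubst (diagMatrix e α) p = p ∧ linSubst (diagMatrix e fun _ => 1) p = p := by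
    refine ⟨fun h => ⟨h _ (Subgroup.subset_closure (by simp)),
      h _ (Subgroup.subset_closure (by simp))⟩, fun h => mem_invariantRing_closure ?_⟩
    rintro g (rfl | rfl)
    exacts [h.1, h.2]
  rw [h1, linSubst_diagMatrix_eq_self_iff he, linSubst_diagMatrix_eq_self_iff he]
  simp only [one_mul, mem_invExponents, Finsupp.degree_eq_sum]
  exact ⟨fun h a ha => ⟨h.2 a ha, h.1 a ha⟩, fun h => ⟨fun a ha => (h a ha).2, fun a ha => (h a ha).1⟩⟩

theorem monomial_mem_GamBar_iff (he : IsPrimitiveRoot e d) {a : Fin (n + 1) →₀ ℕ} :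
    monomial a (1 : K) ∈ invariantRing (GamBar e α) ↔ a ∈ invExponents d α := by
  classical
  rw [mem_invariantRing_GamBar he, support_monomial, if_neg one_ne_zero]
  simp

theorem mem_invMonomials_iff (he : IsPrimitiveRoot e d) {a : Fin (n + 1) →₀ ℕ} :
    a ∈ invMonomials (K := K) d e α ↔ a.degree = d ∧ a ∈ invExponents d α := by
  refine ⟨fun h => ⟨h.1, (monomial_mem_GamBar_iff he).1 (monomial_mem_invariantRing_GamBar he h)⟩,
    fun h => ⟨h.1, fun g hg => ?_⟩⟩
  exact (monomial_mem_GamBar_iff he).2 h.2 g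
    (Subgroup.closure_mono (Set.singleton_subset_iff.2 (Set.mem_insert _ _)) hg)

instance finite_invMonomials : Finite (invMonomials (K := K) d e α) :=
  (Set.Finite.subset (Finsupp.finite_of_degree_eq (σ := Fin (n + 1)) d) fun _ ha => ha.1).to_subtype

/-- The Erdős–Ginzburg–Ziv theorem for monomials. -/
theorem exists_le_mem_invExponents (α : Fin (n + 1) → ℕ) {c : Fin (n + 1) →₀ ℕ}
    (hc : 2 * d - 1 ≤ c.degree) : ∃ b ≤ c, b.degree = d ∧ b ∈ invExponents d α := by
  classical
  -- The monomial is viewed as a multiset of `c.degree` variables, `x_i` labelled by `α i`; `d` of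
  -- them have label sum divisible by `d`.
  obtain ⟨t, hts, hcard, hsum⟩ := Int.erdos_ginzburg_ziv (n := d)
    (s := Finset.univ.sigma fun i => Finset.range (c i)) (fun x => (α x.1 : ℤ)) (by
      simpa [Finsupp.degree_eq_sum] using hc)
  let b : Fin (n + 1) →₀ ℕ := Finsupp.equivFunOnFinite.symm fun i => (t.filter fun x => x.1 = i).card
  have hb : ∀ i, b i = (t.filter fun x => x.1 = i).card := fun i => rfl
  have hdeg : b.degree = d := by
    rw [Finsupp.degree_eq_sum, ← hcard]
    simp only [hb]
    exact (Finset.card_eq_sum_card_fiberwise fun x _ => Finset.mem_coe.2 (Finset.mem_univ x.1)).symm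
  refine ⟨b, fun i => ?_, hdeg, hdeg ▸ dvd_rfl, ?_⟩
  · calc b i ≤ ((Finset.range (c i)).map (Function.Embedding.sigmaMk (β := fun _ : Fin (n + 1) => ℕ) i)).card := by
          refine Finset.card_le_card fun x hx => ?_
          rw [Finset.mem_filter] at hx
          obtain ⟨hx, rfl⟩ := hx
          have := hts hx
          rw [Finset.mem_sigma] at this
          exact Finset.mem_map.2 ⟨x.2, this.2, rfl⟩
      _ = c i := by simp
  · have : ∑ x ∈ t, (α x.1 : ℤ) = ((∑ i, α i * b i : ℕ) : ℤ) := by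
      rw [← Finset.sum_fiberwise_of_maps_to (g := fun x => x.1) (t := Finset.univ) (by simp)]
      push_cast
      refine Finset.sum_congr rfl fun i _ => ?_
      rw [Finset.sum_congr rfl fun x hx => by rw [(Finset.mem_filter.1 hx).2], Finset.sum_const, hb]
      simp [mul_comm]
    rw [this] at hsum
    exact_mod_cast hsum

theorem single_mem_invExponents (i : Fin (n + 1)) :
    Finsupp.single i d ∈ invExponents d α := by
  classical
  refine ⟨by simp, ?_⟩
  refine Finset.dvd_sum fun j _ => ?_
  by_cases h : i = j <;> simp [h]

/-- There are invariant monomials of degree `2 * d` in which every exponent is positive and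
at most `d`. -/
theorem exists_interior_degree_two (hn : 1 ≤ n) (hnd : n < d) (α : Fin (n + 1) → ℕ) :
    ∃ b ∈ invExponents d α, b.degree = 2 * d ∧ ∀ i, 1 ≤ b i ∧ b i ≤ d := by
  -- Here `k` counts the invariant factors of degree `d` removed from `(x_0 ⋯ x_n) ^ d`.
  have key : ∀ k, k + 2 ≤ n + 1 → ∃ b ∈ invExponents d α,
      b.degree = (n + 1 - k) * d ∧ ∀ i, 1 ≤ b i ∧ b i ≤ d := by
    intro k
    induction k with
    | zero =>
      intro _
      refine ⟨∑ i, Finsupp.single i d, sum_mem fun i _ => single_mem_invExponents i, ?_, ?_⟩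
      · simp
      · intro i
        simp [Finsupp.single_apply]
        omega
    | succ k ih =>
      intro hk
      obtain ⟨b, hb, hdeg, hbd⟩ := ih (by omega)
      let u : Fin (n + 1) →₀ ℕ := Finsupp.equivFunOnFinite.symm fun _ => 1
      have hu : u ≤ b := fun i => (hbd i).1
      have hudeg : u.degree = n + 1 := by simp [u, Finsupp.degree_eq_sum]
      obtain ⟨c, rfl⟩ := exists_add_of_le hu
      have h3 : 3 * d ≤ (n + 1 - k) * d := Nat.mul_le_mul_right _ (by omega)
      rw [map_add, hudeg] at hdeg
      -- The factor is taken from `c = b - u`, so one copy of each variable survives. While the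
      -- degree is at least `3 * d`, the degree of `c` is at least `3 * d - (n + 1) ≥ 2 * d`,
      -- because `n < d`.
      obtain ⟨a, hac, hadeg, ha⟩ := exists_le_mem_invExponents (d := d) α (c := c) (by omega)
      obtain ⟨f, rfl⟩ := exists_add_of_le hac
      rw [map_add, hadeg] at hdeg
      refine ⟨u + f, mem_invExponents_of_add_mem ha (by rwa [add_assoc, add_comm f a]), ?_, ?_⟩
      · rw [map_add, hudeg]
        have : (n + 1 - k) * d = (n + 1 - (k + 1)) * d + d := by
          rw [← Nat.succ_mul]; congr 1; omega
        omega
      · intro i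
        have hi := hbd i
        have hui : u i = 1 := rfl
        simp only [Finsupp.add_apply] at hi ⊢
        omega
  obtain ⟨b, hb, hdeg, hbd⟩ := key (n - 1) (by omega)
  exact ⟨b, hb, by rw [hdeg]; congr 1; omega, hbd⟩

/-- The complement `d - a` of an exponent vector. -/
theorem exists_complement {a : Fin (n + 1) →₀ ℕ} (ha : a ∈ invExponents d α)
    (had : ∀ i, a i ≤ d) : ∃ b ∈ invExponents d α,
      a.degree + b.degree = (n + 1) * d ∧ ∀ i, a i + b i = d := by
  have hs : ∑ i, Finsupp.single i d ∈ invExponents d α :=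
    sum_mem fun i _ => single_mem_invExponents i
  have hle : a ≤ ∑ i, Finsupp.single i d := fun i => by
    simpa [Finsupp.single_apply] using had i
  obtain ⟨b, hb⟩ := exists_add_of_le hle
  refine ⟨b, mem_invExponents_of_add_mem ha (by rwa [add_comm b a, ← hb]), ?_, fun i => ?_⟩
  · rw [← map_add, ← hb]
    simp
  · rw [← Finsupp.add_apply, ← hb]
    simp [Finsupp.single_apply]

theorem mem_Cset_one_iff (he : IsPrimitiveRoot e d) {a : Fin (n + 1) →₀ ℕ} :
    a ∈ Cset (K := K) d e α 1 ↔ a ∈ invExponents d α ∧ a.degree = d ∧ ∀ i, 1 ≤ a i := by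
  classical
  constructor
  · rintro ⟨hdeg, f, hf, hfa⟩
    have hmem : a ∈ invExponents d α := (monomial_mem_GamBar_iff he).1 (hfa ▸ f.2)
    refine ⟨hmem, by simpa using hdeg, ?_⟩
    let u : Fin (n + 1) →₀ ℕ := Finsupp.equivFunOnFinite.symm fun _ => 1
    let J : Ideal (MvPolynomial (Fin (n + 1)) K) :=
      Ideal.span ((fun s => monomial s (1 : K)) '' {u})
    -- All generators of `relint` lie in the monomial ideal of the polynomial ring generated by `x_0
    -- ⋯ x_n`, where positivity of exponents can be read off.
    have hle : relint (K := K) e α ≤ J.comap (invariantRing (GamBar e α)).val := by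
      refine Ideal.span_le.2 ?_
      rintro g ⟨b, hb, hgb⟩
      change (g : MvPolynomial (Fin (n + 1)) K) ∈ J
      rw [hgb, mem_ideal_span_monomial_image, support_monomial, if_neg one_ne_zero]
      intro x hx
      rw [Finset.mem_singleton] at hx
      exact ⟨u, rfl, fun i => hx ▸ Nat.one_le_iff_ne_zero.2 (hb i)⟩
    have hfJ : (f : MvPolynomial (Fin (n + 1)) K) ∈ J := hle hf
    rw [hfa, mem_ideal_span_monomial_image, support_monomial, if_neg one_ne_zero] at hfJ
    obtain ⟨_, rfl, h⟩ := hfJ a (Finset.mem_singleton_self a)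
    exact h
  · rintro ⟨hmem, hdeg, hpos⟩
    exact ⟨by simpa using hdeg, ⟨monomial a 1, (monomial_mem_GamBar_iff he).2 hmem⟩,
      Ideal.subset_span ⟨a, fun i => Nat.one_le_iff_ne_zero.1 (hpos i), rfl⟩, rfl⟩

end InvariantMonomials

/-! ### The invariant ring as a module and its regularity -/

noncomputable section InvariantModule

open MvPolynomial

variable {n : ℕ} {K : Type*} [Field K] {d : ℕ} {e : Kˣ} {α : Fin (n + 1) → ℕ}

theorem coe_rhoBar (he : IsPrimitiveRoot e d) (s : coordRing (K := K) d e α) :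
    (rhoBar he α s : MvPolynomial (Fin (n + 1)) K) = rho d e α s := by
  have : (invariantRing (GamBar e α)).val.comp (rhoBar he α) = rho d e α := by
    apply MvPolynomial.algHom_ext
    intro i
    simp [rhoBar, rho]
  exact congrArg (fun f => f s) this

theorem rho_mem {j : ℤ} {p : coordRing (K := K) d e α} (hp : p ∈ polyPiece _ K j) :
    rho d e α p ∈ polyPiece (Fin (n + 1)) K (j * d) := by
  rw [mem_weightedHomogeneousSubmodule] at hp
  induction hp using IsWeightedHomogeneous.induction_on with
  | zero => rw [map_zero]; exact zero_mem _
  | add p q _ _ hp hq => rw [map_add]; exact add_mem hp hq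
  | monomial m c hm =>
    rw [rho, aeval_monomial, algebraMap_eq, ← zero_add (j * d)]
    refine polyPiece_mul (isWeightedHomogeneous_C _ _) ?_
    rw [weight_one_eq_degree] at hm
    have h := IsWeightedHomogeneous.prod (w := fun _ : Fin (n + 1) => (1 : ℤ)) m.support
      (fun a => monomial a.1 (1 : K) ^ m a) (fun a => m a • (d : ℤ)) (by
        intro a _
        refine IsWeightedHomogeneous.pow ?_ _
        refine isWeightedHomogeneous_monomial _ _ _ ?_
        rw [weight_one_eq_degree, a.2.1])
    rw [← Finset.sum_smul] at h
    rw [← hm]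
    simpa [Finsupp.degree_apply, Finsupp.prod] using h

theorem rho_polyComp (hd : d ≠ 0) (j : ℤ) (p : coordRing (K := K) d e α) :
    rho d e α (polyComp j p) = polyComp (j * d) (rho d e α p) := by
  induction p using MvPolynomial.induction_on' with
  | monomial m c =>
    have hm := monomial_mem_polyPiece (K := K) m c
    by_cases h : j = Finsupp.weight (fun _ => (1 : ℤ)) m
    · rw [← h] at hm
      rw [polyComp_of_mem hm, polyComp_of_mem (rho_mem hm)]
    · rw [polyComp_of_mem_of_ne hm h, polyComp_of_mem_of_ne (rho_mem hm), map_zero]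
      exact fun h' => h (mul_right_cancel₀ (by exact_mod_cast hd) h')
  | add p q hp hq => rw [map_add, map_add, hp, hq, map_add, map_add]

theorem polyComp_mem_idealX (hd : d ≠ 0) (j : ℤ) {p : coordRing (K := K) d e α}
    (hp : p ∈ idealX d e α) : polyComp j p ∈ idealX d e α := by
  rw [idealX, RingHom.mem_ker] at hp ⊢
  rw [rho_polyComp hd, hp, map_zero]

theorem constantCoeff_eq_zero_of_mem_idealX (hd : d ≠ 0) {p : coordRing (K := K) d e α}
    (hp : p ∈ idealX d e α) : constantCoeff p = 0 := by
  have h := polyComp_mem_idealX hd 0 hp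
  rw [constantCoeff_polyComp_zero, idealX, RingHom.mem_ker, ← algebraMap_eq,
    AlgHom.commutes] at h
  exact (map_eq_zero _).1 h

/-- An invariant monomial of degree at least `2 * d` has an invariant divisor of degree `d` by
Erdős–Ginzburg–Ziv, and the quotient is again invariant; induction on `t` factors it completely. -/
theorem exists_rhoBar_eq_monomial (he : IsPrimitiveRoot e d) (hd : 0 < d) (t : ℕ) :
    ∀ a : Fin (n + 1) →₀ ℕ, (ha : a ∈ invExponents d α) → a.degree = t * d →
      ∃ s, rhoBar he α s = ⟨monomial a (1 : K), (monomial_mem_GamBar_iff he).2 ha⟩ := by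
  induction t with
  | zero =>
    intro a ha hdeg
    rw [zero_mul, Finsupp.degree_eq_zero_iff] at hdeg
    subst hdeg
    exact ⟨1, by rw [map_one]; rfl⟩
  | succ t ih =>
    intro a ha hdeg
    obtain ⟨b, hba, hbdeg, hb⟩ : ∃ b ≤ a, b.degree = d ∧ b ∈ invExponents d α := by
      obtain _ | t := t
      · exact ⟨a, le_rfl, by simpa using hdeg, ha⟩
      · refine exists_le_mem_invExponents α ?_
        have : (t + 1 + 1) * d = t * d + 2 * d := by ring
        omega
    obtain ⟨c, rfl⟩ := exists_add_of_le hba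
    have hc : c ∈ invExponents d α := mem_invExponents_of_add_mem hb (by rwa [add_comm c b])
    rw [map_add, hbdeg, add_mul, one_mul, add_comm, add_right_cancel_iff] at hdeg
    obtain ⟨s, hs⟩ := ih c hc hdeg
    refine ⟨X ⟨b, (mem_invMonomials_iff he).2 ⟨hbdeg, hb⟩⟩ * s, ?_⟩
    rw [map_mul, hs]
    apply Subtype.ext
    simp [rhoBar, monomial_mul]

theorem eq_sum_monomial_of_mem (he : IsPrimitiveRoot e d)
    (f : invariantRing (GamBar (K := K) e α)) :
    f = ∑ a ∈ (f : MvPolynomial (Fin (n + 1)) K).support.attach,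
      (coeff a.1 (f : MvPolynomial (Fin (n + 1)) K)) • (⟨monomial a.1 (1 : K),
        (monomial_mem_GamBar_iff he).2 ((mem_invariantRing_GamBar he).1 f.2 a.1 a.2)⟩ :
          invariantRing (GamBar (K := K) e α)) := by
  apply Subtype.ext
  rw [AddSubmonoidClass.coe_finsetSum]
  conv_lhs => rw [← support_sum_monomial_coeff (f : MvPolynomial (Fin (n + 1)) K)]
  rw [← Finset.sum_attach]
  refine Finset.sum_congr rfl fun a _ => ?_
  simp [smul_monomial]

/-- The monomial invariants of degree `d` generate the ring of invariants. -/
theorem rhoBar_surjective (he : IsPrimitiveRoot e d) (hd : 0 < d) :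
    Function.Surjective (rhoBar (K := K) he α) := by
  intro f
  rw [← AlgHom.mem_range, eq_sum_monomial_of_mem he f]
  refine sum_mem fun a _ => Subalgebra.smul_mem _ ?_ _
  have ha := (mem_invariantRing_GamBar he).1 f.2 a.1 a.2
  obtain ⟨t, ht⟩ := ha.1
  exact exists_rhoBar_eq_monomial he hd t a.1 ha (by rw [ht, mul_comm])

/-- The variable `w_m` for `m = x_i ^ d`. -/
def powerIndex (he : IsPrimitiveRoot e d) (α : Fin (n + 1) → ℕ) (i : Fin (n + 1)) :
    invMonomials (K := K) d e α :=
  ⟨Finsupp.single i d, (mem_invMonomials_iff he).2 ⟨by simp, single_mem_invExponents i⟩⟩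

theorem coe_smul_invariantModule (he : IsPrimitiveRoot e d) (s : coordRing (K := K) d e α)
    (f : invariantRing (GamBar (K := K) e α)) :
    letI := invariantModule he α
    ((s • f : invariantRing (GamBar (K := K) e α)) : MvPolynomial (Fin (n + 1)) K) =
      rho d e α s * f := by
  rw [← coe_rhoBar he]
  rfl

/-- Membership in the submodule generated by the powers `x_i ^ d` with `i` in some set. -/
theorem mem_varIdeal_smul_top_iff (he : IsPrimitiveRoot e d)
    {T : Set (invMonomials (K := K) d e α)} (hT : T ⊆ Set.range (powerIndex he α))
    (f : invariantRing (GamBar (K := K) e α)) :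
    letI := invariantModule he α
    f ∈ (varIdeal K T • ⊤ :
      Submodule (coordRing (K := K) d e α) (invariantRing (GamBar (K := K) e α))) ↔
      ∀ a ∈ (f : MvPolynomial (Fin (n + 1)) K).support, ∃ i, powerIndex he α i ∈ T ∧ d ≤ a i := by
  classical
  let := invariantModule he α
  let s : Set (Fin (n + 1) →₀ ℕ) := (fun i => Finsupp.single i d) '' {i | powerIndex he α i ∈ T}
  have hs : ∀ p : MvPolynomial (Fin (n + 1)) K,
      p ∈ Ideal.span ((fun s => monomial s (1 : K)) '' s) ↔
        ∀ a ∈ p.support, ∃ i, powerIndex he α i ∈ T ∧ d ≤ a i := by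
    intro p
    rw [mem_ideal_span_monomial_image]
    simp [s]
  constructor
  · intro hf
    rw [← hs]
    have hle : varIdeal K T ≤
        (Ideal.span ((fun s => monomial s (1 : K)) '' s)).comap (rho d e α) := by
      refine Ideal.span_le.2 ?_
      rintro _ ⟨w, hw, rfl⟩
      obtain ⟨i, rfl⟩ := hT hw
      refine Ideal.subset_span ⟨Finsupp.single i d, ⟨i, hw, rfl⟩, ?_⟩
      simp [rho, powerIndex]
    refine Submodule.smul_induction_on (p := fun f : invariantRing (GamBar (K := K) e α) =>
      (f : MvPolynomial (Fin (n + 1)) K) ∈ Ideal.span ((fun s => monomial s (1 : K)) '' s)) hf ?_ ?_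
    · intro r hr g _
      rw [coe_smul_invariantModule]
      exact Ideal.mul_mem_right _ _ (hle hr)
    · intro f g hf hg
      exact add_mem hf hg
  · intro hf
    rw [eq_sum_monomial_of_mem he f]
    refine sum_mem fun a _ => ?_
    obtain ⟨i, hi, hai⟩ := hf a.1 a.2
    have ha := (mem_invariantRing_GamBar he).1 f.2 a.1 a.2
    obtain ⟨b, hb⟩ := exists_add_of_le (Finsupp.single_le_iff.2 hai)
    have hbm : b ∈ invExponents d α :=
      mem_invExponents_of_add_mem (single_mem_invExponents i) (by rwa [add_comm b, ← hb])
    have : (coeff a.1 (f : MvPolynomial (Fin (n + 1)) K)) • (⟨monomial a.1 (1 : K),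
        (monomial_mem_GamBar_iff he).2 ha⟩ : invariantRing (GamBar (K := K) e α)) =
        (X (powerIndex he α i) : coordRing (K := K) d e α) •
          ((coeff a.1 (f : MvPolynomial (Fin (n + 1)) K)) • (⟨monomial b (1 : K),
        (monomial_mem_GamBar_iff he).2 hbm⟩ : invariantRing (GamBar (K := K) e α))) := by
      apply Subtype.ext
      rw [coe_smul_invariantModule]
      simp [rho, powerIndex, smul_monomial, monomial_mul, hb]
    rw [this]
    exact Submodule.smul_mem_smul (X_mem_varIdeal hi) trivial

theorem smul_mem_invariantPiece (he : IsPrimitiveRoot e d) {a j : ℤ}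
    {p : coordRing (K := K) d e α} {f : invariantRing (GamBar (K := K) e α)}
    (hp : p ∈ polyPiece _ K a) (hf : f ∈ invariantPiece d e α j) :
    letI := invariantModule he α
    p • f ∈ invariantPiece d e α (a + j) := by
  let := invariantModule he α
  change ((p • f : invariantRing (GamBar (K := K) e α)) : MvPolynomial (Fin (n + 1)) K) ∈
    polyPiece (Fin (n + 1)) K ((a + j) * d)
  rw [coe_smul_invariantModule, add_mul]
  exact polyPiece_mul (rho_mem hp) hf

/-- The powers `x_i ^ d` form a regular sequence on the ring of invariants. -/
theorem mem_varIdeal_smul_top_of_X_smul_mem (he : IsPrimitiveRoot e d)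
    {T : Set (invMonomials (K := K) d e α)} (hT : T ⊆ Set.range (powerIndex he α))
    {w : invMonomials (K := K) d e α} (hw : w ∈ Set.range (powerIndex he α)) (hwT : w ∉ T)
    (f : invariantRing (GamBar (K := K) e α)) :
    letI := invariantModule he α
    (X w : coordRing (K := K) d e α) • f ∈ (varIdeal K T • ⊤ :
      Submodule (coordRing (K := K) d e α) (invariantRing (GamBar (K := K) e α))) →
    f ∈ (varIdeal K T • ⊤ :
      Submodule (coordRing (K := K) d e α) (invariantRing (GamBar (K := K) e α))) := by
  classical
  let := invariantModule he α
  intro h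
  rw [mem_varIdeal_smul_top_iff he hT] at h ⊢
  obtain ⟨i, rfl⟩ := hw
  intro a ha
  -- The monomial `a` of `f` becomes `x_i ^ d * a` in the product. The power dividing the latter
  -- belongs to some `l ≠ i`, so it already divides `a`.
  obtain ⟨l, hl, hal⟩ := h (Finsupp.single i d + a) (by
    rw [mem_support_iff] at ha ⊢
    rw [coe_smul_invariantModule]
    simpa [rho, powerIndex, coeff_monomial_mul] using ha)
  refine ⟨l, hl, ?_⟩
  have hil : i ≠ l := fun h => hwT (h ▸ hl)
  simpa [Finsupp.single_apply, hil] using hal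

/-- If `ρ` is the largest `t` for which there is an invariant monomial of degree `t * d` with
all exponents smaller than `d`, then `ρ` is the regularity of the ring of invariants and `ρ + 1`
is the regularity of the ideal of relations, provided that `ρ` is positive. -/
theorem regularity_of_isGreatest (he : IsPrimitiveRoot e d) (hd : 0 < d) {ρ : ℕ} (hρ : 0 < ρ)
    (h : IsGreatest {t : ℕ | ∃ a ∈ invExponents d α, a.degree = t * d ∧ ∀ i, a i < d} ρ) :
    letI := invariantModule he α
    IsCastelnuovoMumfordRegularity (invMonomials (K := K) d e α) K (invariantPiece d e α) ρ ∧
      IsCastelnuovoMumfordRegularity (invMonomials (K := K) d e α) K (idealXPiece d e α)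
        (ρ + 1) := by
  classical
  let := invariantModule he α
  obtain ⟨⟨a, ha, hadeg, had⟩, hmax⟩ := h
  let Θ : Finset (invMonomials (K := K) d e α) := Finset.univ.image (powerIndex he α)
  have hΘ : (Θ : Set (invMonomials (K := K) d e α)) = Set.range (powerIndex he α) := by
    simp [Θ]
  refine MinimalGradedFreeResolution.isCastelnuovoMumfordRegularity_of_shift_bounds
    (I := idealX d e α) (by exact_mod_cast hρ)
    (LinearMap.toSpanSingleton (coordRing (K := K) d e α)
      (invariantRing (GamBar (K := K) e α)) 1) ?_ ?_ ?_
    (fun p hp => constantCoeff_eq_zero_of_mem_idealX hd.ne' hp)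
    (fun j p hp => polyComp_mem_idealX hd.ne' j hp) ?_
  · intro f
    obtain ⟨s, rfl⟩ := rhoBar_surjective he hd f
    exact ⟨s, mul_one (rhoBar he α s)⟩
  · ext p
    rw [LinearMap.mem_ker, idealX, RingHom.mem_ker, Subtype.ext_iff,
      LinearMap.toSpanSingleton_apply, coe_smul_invariantModule]
    simp
  · rw [LinearMap.toSpanSingleton_apply, one_smul]
    change (1 : MvPolynomial (Fin (n + 1)) K) ∈ polyPiece (Fin (n + 1)) K (0 * d)
    rw [zero_mul]
    exact one_mem_polyPiece
  · intro F
    -- The functional witnessing degree `ρ` is the coefficient of the reduced monomial `a`: it kills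
    -- the multiples of every `x_i ^ d` and every other degree.
    refine F.shift_bounds (Θ := Θ) (fun a j p m hp hm => smul_mem_invariantPiece he hp hm) ?_ ?_
      ((lcoeff K a).toAddMonoidHom.comp
        (invariantRing (GamBar (K := K) e α)).val.toRingHom.toAddMonoidHom) ?_ ?_ ?_
    · intro T hT w hw hwT m hm
      rw [hΘ] at hT
      exact mem_varIdeal_smul_top_of_X_smul_mem he hT (hΘ ▸ Finset.mem_coe.2 hw) hwT m hm
    · intro j hj f hf
      rw [hΘ, mem_varIdeal_smul_top_iff he subset_rfl]
      intro b hb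
      have hbm := (mem_invariantRing_GamBar he).1 f.2 b hb
      have hdeg : (b.degree : ℤ) = j * d := by
        rw [← weight_one_eq_degree]
        exact hf (mem_support_iff.1 hb)
      by_contra! hcon
      obtain ⟨t, ht⟩ := hbm.1
      have htj : (t : ℤ) = j := by
        have : (t : ℤ) * d = j * d := by rw [← hdeg, ht]; push_cast; ring
        exact mul_right_cancel₀ (by exact_mod_cast hd.ne') this
      have := hmax ⟨b, hbm, by rw [ht, mul_comm], fun i => hcon i ⟨i, rfl⟩⟩
      omega
    · intro f hf
      rw [hΘ, mem_varIdeal_smul_top_iff he subset_rfl] at hf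
      by_contra hne
      obtain ⟨i, -, hi⟩ := hf a (mem_support_iff.2 hne)
      exact absurd (had i) (not_lt.2 hi)
    · intro j hj f hf
      by_contra hne
      have hdeg : Finsupp.weight (fun _ => (1 : ℤ)) a = j * d := hf hne
      rw [weight_one_eq_degree, hadeg] at hdeg
      push_cast at hdeg
      exact hj (mul_right_cancel₀ (by exact_mod_cast hd.ne') hdeg).symm
    · refine ⟨⟨monomial a 1, (monomial_mem_GamBar_iff he).2 ha⟩, ?_⟩
      change coeff a (monomial a (1 : K)) ≠ 0
      simp

/-- The complement `a ↦ d - a` exchanges exponents below `d` with exponents in `[1, d]`, and degree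
`t * d` with `(n + 1 - t) * d`. The cases `t = n` and `t = n - 1` thus concern monomials of degrees
`d` and `2 * d`. -/
theorem isGreatest_reduced_degree (hn : 1 ≤ n) (hnd : n < d) (α : Fin (n + 1) → ℕ) :
    ((∃ b ∈ invExponents d α, b.degree = d ∧ ∀ i, 1 ≤ b i) →
      IsGreatest {t : ℕ | ∃ a ∈ invExponents d α, a.degree = t * d ∧ ∀ i, a i < d} n) ∧
    ((¬ ∃ b ∈ invExponents d α, b.degree = d ∧ ∀ i, 1 ≤ b i) →
      IsGreatest {t : ℕ | ∃ a ∈ invExponents d α, a.degree = t * d ∧ ∀ i, a i < d} (n - 1)) := by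
  have hle : ∀ t, (∃ a ∈ invExponents d α, a.degree = t * d ∧ ∀ i, a i < d) → t ≤ n := by
    rintro t ⟨a, -, hdeg, had⟩
    have : a.degree < (n + 1) * d := by
      rw [Finsupp.degree_eq_sum]
      calc ∑ i, a i < ∑ _i : Fin (n + 1), d :=
            Finset.sum_lt_sum_of_nonempty Finset.univ_nonempty fun i _ => had i
        _ = (n + 1) * d := by simp
    rw [hdeg] at this
    exact Nat.lt_succ_iff.1 (lt_of_mul_lt_mul_right this (Nat.zero_le d))
  constructor
  · rintro ⟨b, hb, hdeg, hpos⟩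
    refine ⟨?_, fun t ht => hle t ht⟩
    -- The upper bound `b i ≤ d` is automatic in degree `d`.
    obtain ⟨a, ha, hab, hsum⟩ := exists_complement hb fun i => hdeg ▸ Finsupp.le_degree i b
    refine ⟨a, ha, ?_, fun i => ?_⟩
    · rw [hdeg, add_mul, one_mul] at hab
      omega
    · have := hsum i; have := hpos i; omega
  · intro hno
    refine ⟨?_, fun t ht => ?_⟩
    · obtain ⟨b, hb, hdeg, hbd⟩ := exists_interior_degree_two hn hnd α
      obtain ⟨a, ha, hab, hsum⟩ := exists_complement hb fun i => (hbd i).2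
      refine ⟨a, ha, ?_, fun i => ?_⟩
      · have : (n + 1) * d = (n - 1) * d + 2 * d := by rw [← add_mul]; congr 1; omega
        omega
      · have := hsum i; have := hbd i; omega
    · have h1 := hle t ht
      by_contra! hlt
      obtain rfl : t = n := by omega
      obtain ⟨a, ha, hdeg, had⟩ := ht
      obtain ⟨b, hb, hab, hsum⟩ := exists_complement ha fun i => (had i).le
      refine hno ⟨b, hb, ?_, fun i => ?_⟩
      · rw [add_mul, one_mul] at hab
        omega
      · have := hsum i; have := had i; omega

end InvariantModule

/-! ### The regularity theorem -/

theorem mainTheorem3 {K : Type*} [Field K] [IsAlgClosed K] [CharZero K]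
    (n d : ℕ) (hn : 2 ≤ n) (hnd : n < d)
    (e : Kˣ) (he : IsPrimitiveRoot e d)
    (α : Fin (n + 1) → ℕ) (hmono : Monotone α) (hlt : ∀ i, α i < d)
    (hgcd : Nat.gcd d (Finset.univ.gcd α) = 1) (hne : ∃ i j, α i < α j) :
    ∃ r : ℤ,
      -- `r` is the regularity of the homogeneous ideal
      IsCastelnuovoMumfordRegularity (invMonomials (K := K) d e α) K
        (idealXPiece (K := K) d e α) r ∧
      -- `r - 1` is the regularity of the ring of invariants as a graded module
      (letI := invariantModule he α
       IsCastelnuovoMumfordRegularity (invMonomials (K := K) d e α) K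
        (invariantPiece (K := K) d e α) (r - 1)) ∧
      (n : ℤ) ≤ r ∧ r ≤ n + 1 ∧
      (r = n + 1 ↔ (Cset (K := K) d e α 1).Nonempty) := by
  have hC : (Cset (K := K) d e α 1).Nonempty ↔
      ∃ b ∈ invExponents d α, b.degree = d ∧ ∀ i, 1 ≤ b i := by
    simp only [Set.Nonempty, mem_Cset_one_iff he]
  have hgr := isGreatest_reduced_degree (by omega) hnd α
  by_cases h : ∃ b ∈ invExponents d α, b.degree = d ∧ ∀ i, 1 ≤ b i
  · obtain ⟨h1, h2⟩ := regularity_of_isGreatest he (by omega) (by omega) (hgr.1 h)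
    exact ⟨n + 1, h2, by rwa [add_sub_cancel_right], by omega, le_rfl, by simp [hC, h]⟩
  -- Here `ρ = n - 1`, which is positive because `2 ≤ n`.
  · obtain ⟨h1, h2⟩ := regularity_of_isGreatest he (by omega) (by omega) (hgr.2 h)
    rw [show ((n - 1 : ℕ) : ℤ) + 1 = n by omega] at h2
    rw [show ((n - 1 : ℕ) : ℤ) = n - 1 by omega] at h1
    exact ⟨n, h2, h1, le_rfl, by omega, by simp [hC, h]⟩
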